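/- Let $Y\subset\mathbb{R}$ be compact, $X=[0,1]$, let $\mu=\mathcal{L}|_{[0,1]}$ be the Lebesgue measure on $X$, let $\nu$ be a Borel probability measure on $Y$, let $\pi_{\mathrm{init}}\in\Pi(\mu,\nu)$ be a transport plan (a measure on $X\times Y$ with marginals $\mu$ and $\nu$), and let $c(x,y)=h(x-y)$ with $h:\mathbb{R}\to\mathbb{R}$ strictly convex. $W_Y$ denotes the Wasserstein-1 distance. For an even integer $n\ge 2$ let $X_i=[i/n,(i+1)/n]$, $i=0,\dots,n-1$, be the basic cells, and put $X_J=\bigcup_{i\in J}X_i$ for a set $J$ of indices. Let $\mathcal{J}_A=\{\{0,1\},\{2,3\},\dots,\{n-2,n-1\}\}$ and $\mathcal{J}_B=\{\{0\},\{1,2\},\dots,\{n-3,n-2\},\{n-1\}\}$. Let $(\pi^{n,k})_{k\ge 0}$ be iterates of the unregularized ($\varepsilon^n=0$) domain decomposition algorithm: $\pi^{n,0}=\pi_{\mathrm{init}}$ and, for $k\ge 1$, $\pi^{n,k}=\sum_{J}\pi^{n,k}_J$, where $J$ runs over $\mathcal{J}_A$ if $k$ is odd and over $\mathcal{J}_B$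 if $k$ is even, and $\pi^{n,k}_J$ minimizes $\int c\,\mathrm{d}\pi$ among all transport plans $\pi$ between $\mu|_{X_J}$ and the $Y$-marginal of $\pi^{n,k-1}|_{X_J\times Y}$. For a plan $\pi$ with first marginal $\mu$ let $\rho_i$ be the $Y$-marginal of $\pi|_{X_i\times Y}$ divided by $\mu(X_i)$, and at level $n$ let $$\mathrm{WTVB}(\pi)=\sum_{i=0}^{n-3}W_Y(\rho_i,\rho_{i+2}).$$ Let $\mathrm{WTV}(\pi_{\mathrm{init}})\in[0,\infty]$ be the total variation over $(0,1)$ of the disintegration $u:x\mapsto\pi_{\mathrm{init},x}$ as a function with values in the metric space $(\mathcal{P}(Y),W_Y)$ of probability measures on $Y$; that is, the mass $\sigma((0,1))$ of the least finite measure $\sigma$ on $(0,1)$ such that $|D(\varphi\circ u)|\le\sigma$ for every $\varphi:\mathcal{P}(Y)\to\mathbb{R}$ with Lipschitz constant at most $1$ (and $\infty$ if there is no such $\sigma$). Then, for all even $n\ge2$ and all $k\ge0$, $$\mathrm{WTVB}(\pi^{n,k})\le 2\,\mathrm{WTV}(\pi_{\mathrm{init}})+4\,\operatorname{diam}Y.$$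 In particular, if $\mathrm{WTV}(\pi_{\mathrm{init}})<\infty$, then $\sup_{n\in 2\mathbb{N},\,k\in\mathbb{N}}\mathrm{WTVB}(\pi^{n,k})<\infty$. -/

import Mathlib

open MeasureTheory Set
open scoped ENNReal

noncomputable section

/-- The set `Π(μ, ν)` of transport plans between `μ` and `ν`. -/
def transportPlans {α β : Type*} [MeasurableSpace α] [MeasurableSpace β]
    (μ : Measure α) (ν : Measure β) : Set (Measure (α × β)) :=
  {π | π.fst = μ ∧ π.snd = ν}

/-- The Wasserstein-1 distance on the real line (for measures of equal mass; it is `∞` if there is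
no transport plan). Measures on a set `Y ⊆ ℝ` are regarded as measures on `ℝ` that do not charge
the complement of `Y`; every plan between two such measures lives on `Y × Y`. -/
def wasserstein (ρ ρ' : Measure ℝ) : ℝ≥0∞ :=
  ⨅ γ ∈ transportPlans ρ ρ', ∫⁻ p, edist p.1 p.2 ∂γ

/-- `π` solves the (unregularized) optimal transport problem between `μ` and `ν` for the cost `c`. -/
def IsOptimalPlan (c : ℝ → ℝ → ℝ) (μ ν : Measure ℝ) (π : Measure (ℝ × ℝ)) : Prop :=
  π ∈ transportPlans μ ν ∧
    ∀ γ ∈ transportPlans μ ν, ∫ p, c p.1 p.2 ∂π ≤ ∫ p, c p.1 p.2 ∂γ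

/-- The Lebesgue measure on `[0, 1]`. -/
def unitLebesgue : Measure ℝ := volume.restrict (Icc 0 1)

/-- The basic cell `i / n + [0, 1 / n]`, for `i ∈ {0, …, n - 1}`. -/
def basicCell (n i : ℕ) : Set ℝ := Icc ((i : ℝ) / n) (((i : ℝ) + 1) / n)

/-- The composite `A` partition of `{0, …, n - 1}`: the groups `{0, 1}, {2, 3}, …, {n - 2, n - 1}`
(for even `n`). -/
def compositeA (n : ℕ) : Finset (Finset ℕ) :=
  (Finset.range (n / 2)).image fun j => (Finset.range n).filter fun i => i / 2 = j

/-- The composite `B` partition of `{0, …, n - 1}`, offset by one basic cell: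
the groups `{0}, {1, 2}, …, {n - 3, n - 2}, {n - 1}` (for even `n`). -/
def compositeB (n : ℕ) : Finset (Finset ℕ) :=
  (Finset.range (n / 2 + 1)).image fun j => (Finset.range n).filter fun i => (i + 1) / 2 = j

/-- The composite partition used in iteration `k`. -/
def compositePartition (n k : ℕ) : Finset (Finset ℕ) :=
  if Odd k then compositeA n else compositeB n

/-- The composite cell `X_J`, the union of the basic cells in `J`. -/
def compositeCell (n : ℕ) (J : Finset ℕ) : Set ℝ := ⋃ i ∈ J, basicCell n i

/-- The `Y`-marginal of the restriction of `π` to `S × Y`. -/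
def partialMarginal (π : Measure (ℝ × ℝ)) (S : Set ℝ) : Measure ℝ :=
  (π.restrict (S ×ˢ univ)).snd

/-- `π 0, π 1, π 2, …` are iterates of the domain decomposition algorithm at discretization level
`n`, without regularization, for the cost `c` and the first marginal `μ`, started at `πinit`: in
iteration `k + 1` the plan is replaced, on each cell `X_J × Y` of the current composite partition,
by an optimal plan with the same marginals. -/
def IsDomDecRun (c : ℝ → ℝ → ℝ) (μ : Measure ℝ) (n : ℕ) (πinit : Measure (ℝ × ℝ))
    (π : ℕ → Measure (ℝ × ℝ)) : Prop :=
  π 0 = πinit ∧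
    ∀ k : ℕ, ∃ γ : Finset ℕ → Measure (ℝ × ℝ),
      (∀ J ∈ compositePartition n (k + 1),
        IsOptimalPlan c (μ.restrict (compositeCell n J))
          (partialMarginal (π k) (compositeCell n J)) (γ J)) ∧
      π (k + 1) = ∑ J ∈ compositePartition n (k + 1), γ J

/-- The normalized `Y`-marginal `ρ_i = ν_i / m_i` of `π` on the basic cell `i`. -/
def basicMarginal (μ : Measure ℝ) (n : ℕ) (π : Measure (ℝ × ℝ)) (i : ℕ) : Measure ℝ :=
  (μ (basicCell n i))⁻¹ • partialMarginal π (basicCell n i)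

/-- The basic-cell total variation `WTVB(π)` at discretization level `n` (in dimension one): the sum
of `W_Y(ρ_i, ρ_{i+2})` over all `i` such that `i` and `i + 2` are indices of basic cells. -/
def WTVB (μ : Measure ℝ) (n : ℕ) (π : Measure (ℝ × ℝ)) : ℝ≥0∞ :=
  ∑ i ∈ Finset.range (n - 2),
    wasserstein (basicMarginal μ n π i) (basicMarginal μ n π (i + 2))

/-- The probability measures on `Y`. -/
def probOn (Y : Set ℝ) : Set (Measure ℝ) := {ρ | IsProbabilityMeasure ρ ∧ ρ Yᶜ = 0}

/-- The measure `σ` dominates, on the interval `(0, 1)`, the variation measure `|D(φ ∘ u)|` of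
`φ ∘ u` for every function `φ` on the metric space `(probOn Y, W_Y)` with Lipschitz constant at
most one. The inequality `|Df| ≤ σ` of measures is expressed by testing the distributional
derivative of `f` with functions `ψ` of class `C¹` with compact support in `(0, 1)`. -/
def DominatesVariation (Y : Set ℝ) (u : ℝ → Measure ℝ) (σ : Measure ℝ) : Prop :=
  ∀ φ : Measure ℝ → ℝ,
    (∀ ρ ∈ probOn Y, ∀ ρ' ∈ probOn Y, edist (φ ρ) (φ ρ') ≤ wasserstein ρ ρ') →
    ∀ ψ : ℝ → ℝ, ContDiff ℝ 1 ψ → HasCompactSupport ψ → tsupport ψ ⊆ Ioo 0 1 →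
      ENNReal.ofReal (∫ x in Ioo (0 : ℝ) 1, φ (u x) * deriv ψ x) ≤ ∫⁻ x, ‖ψ x‖ₑ ∂σ

/-- The total variation over `(0, 1)` of a function `u` with values in the metric space
`(probOn Y, W_Y)`: the mass of the least measure that dominates the variation measures of all
`φ ∘ u`, for `φ` with Lipschitz constant at most one. It is `∞` if there is no such finite
measure. -/
def metricTotalVariation (Y : Set ℝ) (u : ℝ → Measure ℝ) : ℝ≥0∞ :=
  ⨅ (σ : Measure ℝ) (_ : DominatesVariation Y u σ), σ (Ioo 0 1)

/-- The Wasserstein total variation `WTV(π)`: the total variation of the disintegration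
`x ↦ π_x` of `π` with respect to its first marginal. -/
def WTV (Y : Set ℝ) (π : Measure (ℝ × ℝ)) [IsFiniteMeasure π] : ℝ≥0∞ :=
  metricTotalVariation Y fun x => π.condKernel x

end

/-! On the line, W₁ is the L¹ distance of distribution functions, so the problem can be studied for
each level `y` separately. Fix `y` and let `a i` be the value at `y` of the distribution function of
`ρ_i`. An optimal plan for a strictly convex cost of `x - y` has no crossings, hence on a composite
cell `{i, i + 1}` it fills the left cell first with the mass below `y`: `(a, b)` becomes `(min (a +
b) 1, max (a + b - 1) 0)`.

Both new entries are nondecreasing functions of `a + b` and add up to it. The new distance between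
two successive pairs is therefore the difference of their sums, which is at most the old distance.
Summing over pairs, `∑ |a i - a (i + 2)|` does not increase; this is why second neighbours are
compared. To treat the end cells of the B partition in the same way, the sequence is padded by ones
on the left and zeros on the right (`sum_padSeq_step_A`, `sum_padSeq_step_B`). This costs at most 4
for each `y`, hence `4 diam Y` after integration.

For the initial plan, the triangle inequality bounds the second-neighbour sum by twice the
first-neighbour sum. The L¹ distance of consecutive cell averages is attained by a Lipschitz
function `f i`, and a smoothed hat on two adjacent cells turns the difference of averages into a
distributional derivative. Hats add up to at most one, so a single dominating measure `σ` controls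
all cells at once (`sum_ofReal_integral_le_WTV`). -/

/-! ### Rearrangement of pairs in real sequences -/

/-- The functions `min s 1` and `max (s - 1) 0` are both nondecreasing and sum to `s`, so their
increments have the same sign. -/
theorem abs_min_one_sub_add_abs_max_sub (s s' : ℝ) :
    |min s 1 - min s' 1| + |max (s - 1) 0 - max (s' - 1) 0| = |s - s'| := by
  rcases le_total s 1 with h1 | h1 <;> rcases le_total s' 1 with h2 | h2 <;>
    rcases le_total s s' with h3 | h3 <;>
    simp only [min_def, max_def] <;> split_ifs <;>
    simp only [abs_of_nonneg, abs_of_nonpos, sub_nonneg, sub_nonpos, *] <;>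
    grind

/-- Moving mass inside consecutive pairs from the second to the first entry, up to capacity one,
does not increase the sum of the distances of second neighbours. -/
theorem sum_abs_sub_le_of_pairwise_sort {b b' : ℕ → ℝ}
    (h0 : ∀ j, b' (2 * j) = min (b (2 * j) + b (2 * j + 1)) 1)
    (h1 : ∀ j, b' (2 * j + 1) = max (b (2 * j) + b (2 * j + 1) - 1) 0) (M : ℕ) :
    ∑ i ∈ Finset.range (2 * M), |b' i - b' (i + 2)|
      ≤ ∑ i ∈ Finset.range (2 * M), |b i - b (i + 2)| := by
  induction M with
  | zero => simp
  | succ M ih =>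
    rw [show 2 * (M + 1) = 2 * M + 1 + 1 by ring]
    simp only [Finset.sum_range_succ]
    have key := abs_min_one_sub_add_abs_max_sub (b (2 * M) + b (2 * M + 1))
      (b (2 * (M + 1)) + b (2 * (M + 1) + 1))
    rw [← h0, ← h1, ← h0, ← h1] at key
    have e1 : 2 * (M + 1) = 2 * M + 2 := by ring
    have e2 : 2 * M + 2 + 1 = 2 * M + 1 + 2 := by ring
    rw [e1, e2] at key
    have tri : |b (2 * M) + b (2 * M + 1) - (b (2 * M + 2) + b (2 * M + 1 + 2))|
        ≤ |b (2 * M) - b (2 * M + 2)| + |b (2 * M + 1) - b (2 * M + 1 + 2)| := by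
      rw [add_sub_add_comm]
      exact abs_add_le _ _
    linarith

/-! ### Padding at the ends of the interval -/

/-- The extension of a finite sequence by ones on the left and zeros on the right. -/
def padSeq (n : ℕ) (a : ℕ → ℝ) (i : ℕ) : ℝ :=
  if i < 4 then 1 else if i < n + 4 then a (i - 4) else 0

theorem padSeq_add_four {n i : ℕ} (a : ℕ → ℝ) (hi : i < n) : padSeq n a (i + 4) = a i := by
  simp [padSeq, hi]

/-- Four is even, so the pairs stay aligned after padding, and the rearrangement fixes the padded
pairs `(1, 1)` and `(0, 0)`. -/
theorem sum_padSeq_step_A {n : ℕ} (hn : Even n) {a a' : ℕ → ℝ}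
    (h0 : ∀ j, 2 * j + 1 < n → a' (2 * j) = min (a (2 * j) + a (2 * j + 1)) 1)
    (h1 : ∀ j, 2 * j + 1 < n → a' (2 * j + 1) = max (a (2 * j) + a (2 * j + 1) - 1) 0) :
    ∑ i ∈ Finset.range (n + 6), |padSeq n a' i - padSeq n a' (i + 2)|
      ≤ ∑ i ∈ Finset.range (n + 6), |padSeq n a i - padSeq n a (i + 2)| := by
  obtain ⟨m, rfl⟩ := hn
  rw [show m + m + 6 = 2 * (m + 3) by ring]
  have key : ∀ j, padSeq (m + m) a' (2 * j)
        = min (padSeq (m + m) a (2 * j) + padSeq (m + m) a (2 * j + 1)) 1 ∧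
      padSeq (m + m) a' (2 * j + 1)
        = max (padSeq (m + m) a (2 * j) + padSeq (m + m) a (2 * j + 1) - 1) 0 := by
    intro j
    rcases lt_or_ge j 2 with hj | hj
    · interval_cases j <;> norm_num [padSeq]
    obtain ⟨j, rfl⟩ := Nat.exists_eq_add_of_le' hj
    rw [show 2 * (j + 2) = 2 * j + 4 by ring, show 2 * j + 4 + 1 = 2 * j + 1 + 4 by ring]
    rcases lt_or_ge j m with hj | hj
    · rw [padSeq_add_four _ (by omega), padSeq_add_four _ (by omega),
        padSeq_add_four _ (by omega), padSeq_add_four _ (by omega)]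
      exact ⟨h0 j (by omega), h1 j (by omega)⟩
    · have e1 : ¬ 2 * j < m + m := by omega
      have e2 : ¬ 2 * j + 1 < m + m := by omega
      simp [padSeq, e1, e2]
  exact sum_abs_sub_le_of_pairwise_sort (fun j => (key j).1) (fun j => (key j).2) _

/-- The shift drops the term `0` and adds the term `n + 6`; both vanish because the padding is long
enough. It moves the B pairs to the positions of the A pairs. -/
theorem sum_padSeq_shift (n : ℕ) (a : ℕ → ℝ) :
    ∑ i ∈ Finset.range (n + 6), |padSeq n a (i + 1) - padSeq n a (i + 2 + 1)|
      = ∑ i ∈ Finset.range (n + 6), |padSeq n a i - padSeq n a (i + 2)| := by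
  have h1 := Finset.sum_range_succ (fun i => |padSeq n a i - padSeq n a (i + 2)|) (n + 6)
  have h2 := Finset.sum_range_succ' (fun i => |padSeq n a i - padSeq n a (i + 2)|) (n + 6)
  have e1 : |padSeq n a (n + 6) - padSeq n a (n + 6 + 2)| = 0 := by
    have h1 : ¬ n + 6 < 4 := by omega
    have h2 : ¬ n + 6 + 2 < 4 := by omega
    simp [padSeq, h1, h2]
  have e2 : |padSeq n a 0 - padSeq n a (0 + 2)| = 0 := by simp [padSeq]
  rw [e1] at h1
  rw [e2] at h2
  rw [add_zero] at h1 h2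
  rw [← h1, h2]

/-- The singletons at the ends become the pairs `(1, a 0)` and `(a (n - 1), 0)`, which the
rearrangement fixes when the entries lie in `[0, 1]`. -/
theorem sum_padSeq_step_B {n : ℕ} (hn : Even n) (hpos : 0 < n) {a a' : ℕ → ℝ}
    (ha : ∀ i < n, a i ∈ Icc (0 : ℝ) 1) (hfirst : a' 0 = a 0) (hlast : a' (n - 1) = a (n - 1))
    (h0 : ∀ j, 2 * j + 2 < n → a' (2 * j + 1) = min (a (2 * j + 1) + a (2 * j + 2)) 1)
    (h1 : ∀ j, 2 * j + 2 < n → a' (2 * j + 2) = max (a (2 * j + 1) + a (2 * j + 2) - 1) 0) :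
    ∑ i ∈ Finset.range (n + 6), |padSeq n a' i - padSeq n a' (i + 2)|
      ≤ ∑ i ∈ Finset.range (n + 6), |padSeq n a i - padSeq n a (i + 2)| := by
  rw [← sum_padSeq_shift n a, ← sum_padSeq_shift n a']
  obtain ⟨m, rfl⟩ := hn
  rw [show m + m + 6 = 2 * (m + 3) by ring]
  have key : ∀ j, padSeq (m + m) a' (2 * j + 1)
        = min (padSeq (m + m) a (2 * j + 1) + padSeq (m + m) a (2 * j + 1 + 1)) 1 ∧
      padSeq (m + m) a' (2 * j + 1 + 1)
        = max (padSeq (m + m) a (2 * j + 1) + padSeq (m + m) a (2 * j + 1 + 1) - 1) 0 := by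
    intro j
    rcases lt_or_ge j 2 with hj | hj
    · interval_cases j
      · norm_num [padSeq]
      · simp only [padSeq]
        have hm : 0 < m := by omega
        simp [hm, hfirst, (ha 0 hpos).1]
    obtain ⟨j, rfl⟩ := Nat.exists_eq_add_of_le' hj
    rw [show 2 * (j + 2) + 1 = 2 * j + 1 + 4 by ring,
      show 2 * j + 1 + 4 + 1 = 2 * j + 2 + 4 by ring]
    rcases lt_trichotomy (j + 1) m with hj | hj | hj
    · rw [padSeq_add_four _ (by omega), padSeq_add_four _ (by omega),
        padSeq_add_four _ (by omega), padSeq_add_four _ (by omega)]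
      exact ⟨h0 j (by omega), h1 j (by omega)⟩
    · have e1 : 2 * j + 1 = m + m - 1 := by omega
      have e2 : ¬ 2 * j + 2 < m + m := by omega
      have e3 : 2 * j + 1 < m + m := by omega
      rw [padSeq_add_four _ e3, padSeq_add_four _ e3, e1, hlast]
      simp [padSeq, e2, (ha (m + m - 1) (by omega)).2]
    · have e1 : ¬ 2 * j + 1 < m + m := by omega
      have e2 : ¬ 2 * j + 2 < m + m := by omega
      simp [padSeq, e1, e2]
  exact sum_abs_sub_le_of_pairwise_sort (b := fun i => padSeq (m + m) a (i + 1))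
    (b' := fun i => padSeq (m + m) a' (i + 1)) (fun j => (key j).1) (fun j => (key j).2) _

theorem sum_le_sum_padSeq (n : ℕ) (a : ℕ → ℝ) :
    ∑ i ∈ Finset.range (n - 2), |a i - a (i + 2)|
      ≤ ∑ i ∈ Finset.range (n + 6), |padSeq n a i - padSeq n a (i + 2)| := by
  calc ∑ i ∈ Finset.range (n - 2), |a i - a (i + 2)|
      = ∑ i ∈ Finset.range (n - 2), |padSeq n a (4 + i) - padSeq n a (4 + i + 2)| := by
        refine Finset.sum_congr rfl fun i hi => ?_
        have : i + 2 < n := by have := Finset.mem_range.1 hi; omega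
        rw [show 4 + i + 2 = i + 2 + 4 by ring, show 4 + i = i + 4 by ring,
          padSeq_add_four _ this, padSeq_add_four _ (by omega)]
    _ ≤ ∑ i ∈ Finset.range (4 + (n - 2)), |padSeq n a i - padSeq n a (i + 2)| := by
        rw [Finset.sum_range_add]
        exact le_add_of_nonneg_left (Finset.sum_nonneg fun _ _ => abs_nonneg _)
    _ ≤ _ := Finset.sum_le_sum_of_subset_of_nonneg
        (Finset.range_mono (by omega)) fun _ _ _ => abs_nonneg _

/-- Only four extra terms can be nonzero, two at each end, each at most one. This is the origin of
the constant 4. -/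
theorem sum_padSeq_le {n : ℕ} (hn : 2 ≤ n) {a : ℕ → ℝ} (ha : ∀ i < n, a i ∈ Icc (0 : ℝ) 1) :
    ∑ i ∈ Finset.range (n + 6), |padSeq n a i - padSeq n a (i + 2)|
      ≤ ∑ i ∈ Finset.range (n - 2), |a i - a (i + 2)| + 4 := by
  obtain ⟨m, rfl⟩ := Nat.exists_eq_add_of_le' hn
  rw [show m + 2 + 6 = 4 + m + 4 by ring, Finset.sum_range_add, Finset.sum_range_add]
  have e : ∑ i ∈ Finset.range m, |padSeq (m + 2) a (4 + i) - padSeq (m + 2) a (4 + i + 2)|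
      = ∑ i ∈ Finset.range (m + 2 - 2), |a i - a (i + 2)| := by
    refine Finset.sum_congr rfl fun i hi => ?_
    have := Finset.mem_range.1 hi
    rw [show 4 + i + 2 = i + 2 + 4 by ring, show 4 + i = i + 4 by ring,
      padSeq_add_four _ (by omega), padSeq_add_four _ (by omega)]
  have e1 : ∑ i ∈ Finset.range 4, |padSeq (m + 2) a i - padSeq (m + 2) a (i + 2)|
      ≤ 2 := by
    simp only [Finset.sum_range_succ, Finset.sum_range_zero, padSeq]
    norm_num
    rw [abs_of_nonneg (by linarith [(ha 0 (by omega)).2]), abs_of_nonneg (by linarith [(ha 1 (by omega)).2])]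
    linarith [(ha 0 (by omega)).1, (ha 1 (by omega)).1]
  have e2 : ∑ i ∈ Finset.range 4,
      |padSeq (m + 2) a (4 + m + i) - padSeq (m + 2) a (4 + m + i + 2)| ≤ 2 := by
    have p0 : padSeq (m + 2) a (4 + m) = a m := by
      rw [add_comm 4 m, padSeq_add_four _ (by omega)]
    have p1 : padSeq (m + 2) a (4 + m + 1) = a (m + 1) := by
      rw [show 4 + m + 1 = m + 1 + 4 by ring, padSeq_add_four _ (by omega)]
    have p2 : ∀ i, 2 ≤ i → padSeq (m + 2) a (4 + m + i) = 0 := by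
      intro i hi
      have e1 : ¬ 4 + m + i < 4 := by omega
      have e2 : ¬ 4 + m + i < m + 2 + 4 := by omega
      simp [padSeq, e1, e2]
    simp only [Finset.sum_range_succ, Finset.sum_range_zero, add_assoc (4 + m)]
    simp only [add_zero, p0, p1, zero_add]
    rw [p2 2 le_rfl, p2 (1 + 2) (by omega), p2 (2 + 2) (by omega),
      p2 (3 + 2) (by omega), sub_zero, sub_zero, abs_of_nonneg (ha _ (by omega)).1,
      abs_of_nonneg (ha _ (by omega)).1]
    simp only [sub_self, abs_zero]
    linarith [(ha m (by omega)).2, (ha (m + 1) (by omega)).2]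
  linarith

theorem sum_abs_sub_two_le (n : ℕ) (a : ℕ → ℝ) :
    ∑ i ∈ Finset.range (n - 2), |a i - a (i + 2)|
      ≤ 2 * ∑ i ∈ Finset.range (n - 1), |a i - a (i + 1)| := by
  rcases Nat.lt_or_ge n 2 with hn | hn
  · rw [show n - 2 = 0 by omega, Finset.range_zero, Finset.sum_empty]
    exact mul_nonneg zero_le_two (Finset.sum_nonneg fun _ _ => abs_nonneg _)
  obtain ⟨m, rfl⟩ := Nat.exists_eq_add_of_le' hn
  rw [show m + 2 - 2 = m by omega, show m + 2 - 1 = m + 1 by omega]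
  have h1 := Finset.sum_range_succ (fun i => |a i - a (i + 1)|) m
  have h2 := Finset.sum_range_succ' (fun i => |a i - a (i + 1)|) m
  have h3 : ∑ i ∈ Finset.range m, |a i - a (i + 2)|
      ≤ ∑ i ∈ Finset.range m, |a i - a (i + 1)|
        + ∑ i ∈ Finset.range m, |a (i + 1) - a (i + 1 + 1)| := by
    rw [← Finset.sum_add_distrib]
    exact Finset.sum_le_sum fun i _ => abs_sub_le _ _ _
  have h4 := abs_nonneg (a m - a (m + 1))
  have h5 := abs_nonneg (a 0 - a (0 + 1))
  linarith

/-! ### The Wasserstein-1 distance on the line -/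

/-- The quantile function of a probability measure on the real line. -/
noncomputable def quantile (ρ : Measure ℝ) (s : ℝ) : ℝ := sInf {y | s ≤ ProbabilityTheory.cdf ρ y}

theorem quantile_le_iff (ρ : Measure ℝ) {s : ℝ} (hs : s ∈ Ioo (0 : ℝ) 1) (y : ℝ) :
    quantile ρ s ≤ y ↔ s ≤ ProbabilityTheory.cdf ρ y := by
  have hne : {y | s ≤ ProbabilityTheory.cdf ρ y}.Nonempty :=
    ((ProbabilityTheory.tendsto_cdf_atTop ρ).eventually (eventually_ge_nhds hs.2)).exists
  have hbdd : BddBelow {y | s ≤ ProbabilityTheory.cdf ρ y} := by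
    obtain ⟨z, hz⟩ := ((ProbabilityTheory.tendsto_cdf_atBot ρ).eventually_lt_const hs.1).exists
    refine ⟨z, fun w hw => ?_⟩
    by_contra! hwz
    exact absurd (hw.trans (ProbabilityTheory.monotone_cdf ρ hwz.le)) (not_le.2 hz)
  refine ⟨fun h => ?_, fun h => csInf_le hbdd h⟩
  -- Right continuity of the distribution function shows that the infimum defining the quantile is
  -- attained.
  rw [← StieltjesFunction.iInf_Ioi_eq]
  refine le_ciInf fun ⟨z, hz⟩ => ?_
  obtain ⟨w, hw, hwz⟩ := exists_lt_of_csInf_lt hne (lt_of_le_of_lt h hz)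
  exact le_trans hw (ProbabilityTheory.monotone_cdf ρ hwz.le)

theorem aemeasurable_quantile (ρ : Measure ℝ) :
    AEMeasurable (quantile ρ) (volume.restrict (Ioo 0 1)) := by
  refine aemeasurable_restrict_of_monotoneOn measurableSet_Ioo fun s hs t ht hst => ?_
  rw [quantile_le_iff ρ hs]
  exact hst.trans ((quantile_le_iff ρ ht _).1 le_rfl)

theorem map_quantile (ρ : Measure ℝ) [IsProbabilityMeasure ρ] :
    (volume.restrict (Ioo (0 : ℝ) 1)).map (quantile ρ) = ρ := by
  have : IsFiniteMeasure ((volume.restrict (Ioo (0 : ℝ) 1)).map (quantile ρ)) :=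
    Measure.isFiniteMeasure_map _ _
  refine Measure.ext_of_Iic _ _ fun y => ?_
  rw [Measure.map_apply_of_aemeasurable (aemeasurable_quantile ρ) measurableSet_Iic,
    ← ProbabilityTheory.ofReal_cdf ρ y]
  have h1 : (volume.restrict (Ioo (0 : ℝ) 1)) (quantile ρ ⁻¹' Iic y)
      = (volume.restrict (Ioo (0 : ℝ) 1)) (Iic (ProbabilityTheory.cdf ρ y)) := by
    refine measure_congr ?_
    filter_upwards [ae_restrict_mem measurableSet_Ioo] with s hs
    exact propext (quantile_le_iff ρ hs y)
  rw [h1, Measure.restrict_congr_set Ioo_ae_eq_Ioc, Measure.restrict_apply measurableSet_Iic,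
    inter_comm, Ioc_inter_Iic, min_eq_right (ProbabilityTheory.cdf_le_one ρ y), Real.volume_Ioc,
    sub_zero]

theorem volume_setOf_mem_uIoc_cdf (ρ ρ' : Measure ℝ) {s : ℝ} (hs : s ∈ Ioo (0 : ℝ) 1) :
    volume {y | s ∈ uIoc (ProbabilityTheory.cdf ρ y) (ProbabilityTheory.cdf ρ' y)}
      = edist (quantile ρ s) (quantile ρ' s) := by
  have : {y | s ∈ uIoc (ProbabilityTheory.cdf ρ y) (ProbabilityTheory.cdf ρ' y)}
      = Ico (min (quantile ρ s) (quantile ρ' s)) (max (quantile ρ s) (quantile ρ' s)) := by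
    ext y
    simp only [mem_ofPred_eq, mem_uIoc, mem_Ico, min_le_iff, ← not_le, max_le_iff,
      quantile_le_iff ρ hs, quantile_le_iff ρ' hs]
    tauto
  rw [this, Real.volume_Ico, max_sub_min_eq_abs', edist_dist, Real.dist_eq]

/-- On the real line the Wasserstein-1 distance is at most the `L¹` distance of the distribution
functions. -/
theorem wasserstein_le_lintegral_cdf (ρ ρ' : Measure ℝ) [IsProbabilityMeasure ρ]
    [IsProbabilityMeasure ρ'] :
    wasserstein ρ ρ' ≤ ∫⁻ y, ENNReal.ofReal |ρ.real (Iic y) - ρ'.real (Iic y)| := by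
  set P := volume.restrict (Ioo (0 : ℝ) 1)
  set γ := P.map fun s => (quantile ρ s, quantile ρ' s)
  have hm := aemeasurable_quantile ρ
  have hm' := aemeasurable_quantile ρ'
  have hγ : γ ∈ transportPlans ρ ρ' :=
    ⟨(Measure.fst_map_prodMk₀ hm').trans (map_quantile ρ),
      (Measure.snd_map_prodMk₀ hm).trans (map_quantile ρ')⟩
  have hF : Measurable (ProbabilityTheory.cdf ρ) := (ProbabilityTheory.monotone_cdf ρ).measurable
  have hF' : Measurable (ProbabilityTheory.cdf ρ') := (ProbabilityTheory.monotone_cdf ρ').measurable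
  -- The region between the two graphs: its slices at fixed `s` have the length of the quantile
  -- displacement, those at fixed `y` the difference of the distribution functions. Tonelli compares
  -- the two.
  set S : Set (ℝ × ℝ) :=
    {p | p.1 ∈ uIoc (ProbabilityTheory.cdf ρ p.2) (ProbabilityTheory.cdf ρ' p.2)}
  have hS : MeasurableSet S := by
    refine MeasurableSet.inter
      (measurableSet_lt ((hF.comp measurable_snd).min (hF'.comp measurable_snd)) measurable_fst)
      (measurableSet_le measurable_fst ((hF.comp measurable_snd).max (hF'.comp measurable_snd)))
  calc wasserstein ρ ρ' ≤ ∫⁻ p, edist p.1 p.2 ∂γ := iInf₂_le γ hγ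
    _ = ∫⁻ s, edist (quantile ρ s) (quantile ρ' s) ∂P :=
        lintegral_map' (measurable_fst.edist measurable_snd).aemeasurable (hm.prodMk hm')
    _ = ∫⁻ s, volume (Prod.mk s ⁻¹' S) ∂P := by
        refine lintegral_congr_ae ?_
        filter_upwards [ae_restrict_mem measurableSet_Ioo] with s hs
        exact (volume_setOf_mem_uIoc_cdf ρ ρ' hs).symm
    _ = (P.prod volume) S := (Measure.prod_apply hS).symm
    _ = ∫⁻ y, P ((fun s => (s, y)) ⁻¹' S) := Measure.prod_apply_symm hS
    _ ≤ _ := by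
        refine lintegral_mono fun y => ?_
        refine (Measure.restrict_apply_le _ _).trans ?_
        change volume (uIoc (ProbabilityTheory.cdf ρ y) (ProbabilityTheory.cdf ρ' y)) ≤ _
        rw [Real.volume_uIoc, abs_sub_comm, ProbabilityTheory.cdf_eq_real,
          ProbabilityTheory.cdf_eq_real]

theorem real_Iic_of_lt {ρ : Measure ℝ} {α β y : ℝ} (h : ρ (Icc α β)ᶜ = 0) (hy : y < α) :
    ρ.real (Iic y) = 0 := by
  rw [measureReal_def, measure_mono_null (fun z hz hz' => ?_) h, ENNReal.toReal_zero]
  exact absurd (hz'.1.trans hz) (not_le.2 hy)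

theorem real_Iic_of_le {ρ : Measure ℝ} [IsProbabilityMeasure ρ] {α β y : ℝ}
    (h : ρ (Icc α β)ᶜ = 0) (hy : β ≤ y) : ρ.real (Iic y) = 1 := by
  have h1 : ρ (Iic y) = 1 := by
    rw [prob_compl_eq_zero_iff measurableSet_Icc] at h
    exact le_antisymm prob_le_one (h ▸ measure_mono fun z hz => hz.2.trans hy)
  rw [measureReal_def, h1, ENNReal.toReal_one]

theorem wasserstein_le_setLIntegral_Icc {ρ ρ' : Measure ℝ} [IsProbabilityMeasure ρ]
    [IsProbabilityMeasure ρ'] {α β : ℝ} (h : ρ (Icc α β)ᶜ = 0) (h' : ρ' (Icc α β)ᶜ = 0) :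
    wasserstein ρ ρ'
      ≤ ∫⁻ y in Icc α β, ENNReal.ofReal |ρ.real (Iic y) - ρ'.real (Iic y)| := by
  refine (wasserstein_le_lintegral_cdf ρ ρ').trans (le_of_eq ?_)
  refine (setLIntegral_eq_of_support_subset fun y hy => ?_).symm
  by_contra hy'
  refine hy ?_
  rw [mem_Icc, not_and_or, not_le, not_le] at hy'
  rcases hy' with hy' | hy'
  · simp [real_Iic_of_lt h hy', real_Iic_of_lt h' hy']
  · simp [real_Iic_of_le h hy'.le, real_Iic_of_le h' hy'.le]

/-- Integrals of `1`-Lipschitz functions are `1`-Lipschitz for the Wasserstein-1 distance. -/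
theorem edist_integral_le_wasserstein {f : ℝ → ℝ} (hf : LipschitzWith 1 f) {ρ ρ' : Measure ℝ}
    (hi : Integrable f ρ) (hi' : Integrable f ρ') :
    edist (∫ z, f z ∂ρ) (∫ z, f z ∂ρ') ≤ wasserstein ρ ρ' := by
  refine le_iInf₂ fun γ hγ => ?_
  obtain ⟨rfl, rfl⟩ := hγ
  have hm := hf.continuous.measurable
  have e1 : ∫ z, f z ∂γ.fst = ∫ p, f p.1 ∂γ :=
    integral_map measurable_fst.aemeasurable hm.aestronglyMeasurable
  have e2 : ∫ z, f z ∂γ.snd = ∫ p, f p.2 ∂γ :=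
    integral_map measurable_snd.aemeasurable hm.aestronglyMeasurable
  have i1 : Integrable (fun p : ℝ × ℝ => f p.1) γ := hi.comp_measurable measurable_fst
  have i2 : Integrable (fun p : ℝ × ℝ => f p.2) γ := hi'.comp_measurable measurable_snd
  rw [e1, e2, edist_eq_enorm_sub, ← integral_sub i1 i2]
  refine (enorm_integral_le_lintegral_enorm _).trans (lintegral_mono fun p => ?_)
  rw [← edist_eq_enorm_sub]
  simpa using hf p.1 p.2

/-! ### Optimal plans have no crossings -/

/-- The points `x - y` and `x' - y'` are convex combinations of `x - y'` and `x' - y` with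
interchanged weights; add the two strict convexity inequalities. -/
theorem StrictConvexOn.exchange_lt {h : ℝ → ℝ} (hh : StrictConvexOn ℝ univ h) {x x' y y' : ℝ}
    (hx : x < x') (hy : y < y') :
    h (x - y) + h (x' - y') < h (x - y') + h (x' - y) := by
  have hd : 0 < (x' - x) + (y' - y) := by linarith
  set d := (x' - x) + (y' - y) with hd'
  have e1 : ((x' - x) / d) + ((y' - y) / d) = 1 := by
    rw [← add_div, ← hd', div_self hd.ne']
  have hlt : x - y' ≠ x' - y := by intro e; linarith
  have k1 := hh.2 (mem_univ (x - y')) (mem_univ (x' - y)) hlt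
    (div_pos (sub_pos.2 hx) hd) (div_pos (sub_pos.2 hy) hd) e1
  have k2 := hh.2 (mem_univ (x - y')) (mem_univ (x' - y)) hlt
    (div_pos (sub_pos.2 hy) hd) (div_pos (sub_pos.2 hx) hd) (by rw [add_comm]; exact e1)
  simp only [smul_eq_mul] at k1 k2
  have a1 : (x' - x) / d * (x - y') + (y' - y) / d * (x' - y) = x - y := by
    field_simp
    rw [hd']; ring
  have a2 : (y' - y) / d * (x - y') + (x' - x) / d * (x' - y) = x' - y' := by
    field_simp
    rw [hd']; ring
  rw [a1] at k1
  rw [a2] at k2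
  have a3 : (x' - x) / d = 1 - (y' - y) / d := by linarith
  rw [a3] at k1 k2
  linarith

theorem integrable_of_null_compl_compact {c : ℝ × ℝ → ℝ} (hc : Continuous c)
    {M : Measure (ℝ × ℝ)} [IsFiniteMeasure M] {K L : Set ℝ} (hK : IsCompact K) (hL : IsCompact L)
    (hMK : M.fst Kᶜ = 0) (hML : M.snd Lᶜ = 0) : Integrable c M := by
  have hKm := hK.measurableSet
  have hLm := hL.measurableSet
  rw [Measure.fst_apply hKm.compl] at hMK
  rw [Measure.snd_apply hLm.compl] at hML
  have h0 : M (K ×ˢ L)ᶜ = 0 := by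
    refine measure_mono_null (fun p hp => ?_) (measure_union_null hMK hML)
    by_contra hp'
    simp only [mem_union, mem_preimage, mem_compl_iff, not_or, not_not] at hp'
    exact hp ⟨hp'.1, hp'.2⟩
  have : M.restrict (K ×ˢ L) = M := Measure.restrict_eq_self_of_ae_mem h0
  rw [← this]
  exact hc.continuousOn.integrableOn_compact (hK.prod hL)

/-- An optimal plan for a strictly convex cost of the difference has no crossings. -/
theorem IsOptimalPlan.null_or_null {h : ℝ → ℝ} (hh : StrictConvexOn ℝ univ h)
    {μ ν : Measure ℝ} {γ : Measure (ℝ × ℝ)}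
    (hγ : IsOptimalPlan (fun x y => h (x - y)) μ ν γ) (hmass : γ univ ≤ 1) {K L : Set ℝ}
    (hK : IsCompact K) (hL : IsCompact L) (hμ : μ Kᶜ = 0) (hν : ν Lᶜ = 0) (t y : ℝ) :
    γ (Iic t ×ˢ Ioi y) = 0 ∨ γ (Ioi t ×ˢ Iic y) = 0 := by
  by_contra! hne
  obtain ⟨⟨rfl, rfl⟩, hopt⟩ := hγ
  have hfin : IsFiniteMeasure γ := ⟨hmass.trans_lt ENNReal.one_lt_top⟩
  set c : ℝ × ℝ → ℝ := fun p => h (p.1 - p.2) with hcdef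
  have hh' : Continuous h := continuousOn_univ.1 (hh.convexOn.continuousOn isOpen_univ)
  have hc : Continuous c := hh'.comp (continuous_fst.sub continuous_snd)
  set A : Set (ℝ × ℝ) := Iic t ×ˢ Ioi y
  set B : Set (ℝ × ℝ) := Ioi t ×ˢ Iic y
  have hA : MeasurableSet A := measurableSet_Iic.prod measurableSet_Ioi
  have hB : MeasurableSet B := measurableSet_Ioi.prod measurableSet_Iic
  have hAB : Disjoint A B := (Iic_disjoint_Ioi le_rfl).set_prod_left _ _
  set γA := γ.restrict A with hγA
  set γB := γ.restrict B with hγB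
  set γR := γ.restrict (A ∪ B)ᶜ with hγR
  have hsplit : γR + (γA + γB) = γ := by
    rw [hγA, hγB, ← Measure.restrict_union hAB hB, hγR, add_comm]
    exact Measure.restrict_add_restrict_compl (hA.union hB)
  set a := γA univ with ha
  set b := γB univ with hb
  have ha0 : a ≠ 0 := by rw [ha, hγA, Measure.restrict_apply_univ]; exact hne.1
  have hb0 : b ≠ 0 := by rw [hb, hγB, Measure.restrict_apply_univ]; exact hne.2
  have ha1 : a ≤ 1 := by
    rw [ha, hγA, Measure.restrict_apply_univ]; exact (measure_mono (subset_univ _)).trans hmass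
  have hb1 : b ≤ 1 := by
    rw [hb, hγB, Measure.restrict_apply_univ]; exact (measure_mono (subset_univ _)).trans hmass
  -- The competitor removes `b • γA` and `a • γB`, each of mass `a * b`, and puts back the products
  -- with the second coordinates exchanged. Total mass at most one makes `1 - a` and `1 - b` true
  -- differences, so the marginals are kept.
  set P := γA.fst.prod γB.snd with hP
  set Q := γB.fst.prod γA.snd with hQ
  set γ' := γR + ((1 - b) • γA + (1 - a) • γB) + (P + Q) with hγ'
  have hPf : P.fst = b • γA.fst := by
    rw [hP, Measure.fst, Measure.map_fst_prod, Measure.snd_univ]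
  have hPs : P.snd = a • γB.snd := by
    rw [hP, Measure.snd, Measure.map_snd_prod, Measure.fst_univ]
  have hQf : Q.fst = a • γB.fst := by
    rw [hQ, Measure.fst, Measure.map_fst_prod, Measure.snd_univ]
  have hQs : Q.snd = b • γA.snd := by
    rw [hQ, Measure.snd, Measure.map_snd_prod, Measure.fst_univ]
  have hsm : ∀ (e : ℝ≥0∞) (m : Measure ℝ), e ≤ 1 → (1 - e) • m + e • m = m := by
    intro e m he
    rw [← add_smul, tsub_add_cancel_of_le he, one_smul]
  have hfst : γ'.fst = γ.fst := by
    rw [hγ', Measure.fst_add, Measure.fst_add, Measure.fst_add, Measure.fst_add, hPf, hQf]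
    rw [← congrArg Measure.fst hsplit, Measure.fst_add, Measure.fst_add]
    have e1 : ((1 - b) • γA).fst = (1 - b) • γA.fst := Measure.map_smul _ _ _
    have e2 : ((1 - a) • γB).fst = (1 - a) • γB.fst := Measure.map_smul _ _ _
    rw [e1, e2, add_assoc, add_add_add_comm, hsm _ _ hb1, hsm _ _ ha1]
  have hsnd : γ'.snd = γ.snd := by
    rw [hγ', Measure.snd_add, Measure.snd_add, Measure.snd_add, Measure.snd_add, hPs, hQs]
    rw [← congrArg Measure.snd hsplit, Measure.snd_add, Measure.snd_add]
    have e1 : ((1 - b) • γA).snd = (1 - b) • γA.snd := Measure.map_smul _ _ _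
    have e2 : ((1 - a) • γB).snd = (1 - a) • γB.snd := Measure.map_smul _ _ _
    rw [e1, e2, add_assoc, add_comm (a • γB.snd), add_add_add_comm, hsm _ _ hb1, hsm _ _ ha1]
  have hle := hopt γ' ⟨hfst, hsnd⟩
  -- Compactness rules out the default value zero of a non-integrable cost.
  have hI : ∀ M : Measure (ℝ × ℝ), M.fst ≪ γ.fst → M.snd ≪ γ.snd → IsFiniteMeasure M →
      Integrable c M := fun M h1 h2 _ =>
    integrable_of_null_compl_compact hc hK hL (h1 hμ) (h2 hν)
  have hIγ := hI γ .rfl .rfl hfin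
  have hIA : Integrable c γA := hIγ.restrict
  have hIB : Integrable c γB := hIγ.restrict
  have hIR : Integrable c γR := hIγ.restrict
  have hAf : γA.fst ≪ γ.fst := (Measure.fst_mono Measure.restrict_le_self).absolutelyContinuous
  have hAs : γA.snd ≪ γ.snd := (Measure.snd_mono Measure.restrict_le_self).absolutelyContinuous
  have hBf : γB.fst ≪ γ.fst := (Measure.fst_mono Measure.restrict_le_self).absolutelyContinuous
  have hBs : γB.snd ≪ γ.snd := (Measure.snd_mono Measure.restrict_le_self).absolutelyContinuous
  have hIP : Integrable c P := hI P (hPf ▸ (Measure.smul_absolutelyContinuous).trans hAf)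
    (hPs ▸ (Measure.smul_absolutelyContinuous).trans hBs) inferInstance
  have hIQ : Integrable c Q := hI Q (hQf ▸ (Measure.smul_absolutelyContinuous).trans hBf)
    (hQs ▸ (Measure.smul_absolutelyContinuous).trans hAs) inferInstance
  have hb1' : 1 - b ≠ ∞ := ENNReal.sub_ne_top ENNReal.one_ne_top
  have ha1' : 1 - a ≠ ∞ := ENNReal.sub_ne_top ENNReal.one_ne_top
  have e1 : ∫ p, c p ∂γ' = ∫ p, c p ∂γR + ((1 - b.toReal) * ∫ p, c p ∂γA
      + (1 - a.toReal) * ∫ p, c p ∂γB) + (∫ p, c p ∂P + ∫ p, c p ∂Q) := by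
    have jA := hIA.smul_measure hb1'
    have jB := hIB.smul_measure ha1'
    rw [hγ', integral_add_measure (hIR.add_measure (jA.add_measure jB)) (hIP.add_measure hIQ),
      integral_add_measure hIR (jA.add_measure jB), integral_add_measure jA jB,
      integral_add_measure hIP hIQ, integral_smul_measure, integral_smul_measure,
      ENNReal.toReal_sub_of_le hb1 ENNReal.one_ne_top,
      ENNReal.toReal_sub_of_le ha1 ENNReal.one_ne_top]
    simp
  have e2 : ∫ p, c p ∂γ = ∫ p, c p ∂γR + (∫ p, c p ∂γA + ∫ p, c p ∂γB) := by
    conv_lhs => rw [← hsplit]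
    rw [integral_add_measure hIR (hIA.add_measure hIB), integral_add_measure hIA hIB]
  have hle' : b.toReal * ∫ p, c p ∂γA + a.toReal * ∫ p, c p ∂γB
      ≤ ∫ p, c p ∂P + ∫ p, c p ∂Q := by
    have : ∫ p, c p ∂γ ≤ ∫ p, c p ∂γ' := hle
    rw [e1, e2] at this
    linarith
  -- All four cost terms are integrals over `N`, so the gain of the exchange is the integral of a
  -- function `D` that is positive almost everywhere, while optimality makes this integral
  -- nonpositive.
  set N := γA.prod γB with hN
  have mP : Measurable fun r : (ℝ × ℝ) × (ℝ × ℝ) => (r.1.1, r.2.2) := by fun_prop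
  have mQ : Measurable fun r : (ℝ × ℝ) × (ℝ × ℝ) => (r.2.1, r.1.2) := by fun_prop
  have hPN : P = N.map fun r => (r.1.1, r.2.2) :=
    Measure.map_prod_map γA γB measurable_fst measurable_snd
  have hQN : Q = N.map fun r => (r.2.1, r.1.2) := by
    have k : Q = (γB.prod γA).map (Prod.map Prod.fst Prod.snd) :=
      Measure.map_prod_map γB γA measurable_fst measurable_snd
    rw [k, ← Measure.prod_swap, Measure.map_map (by fun_prop) measurable_swap]
    rfl
  have i1 : Integrable (fun r : (ℝ × ℝ) × (ℝ × ℝ) => c r.1) N := hIA.comp_fst γB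
  have i2 : Integrable (fun r : (ℝ × ℝ) × (ℝ × ℝ) => c r.2) N := hIB.comp_snd γA
  have i3 : Integrable (fun r : (ℝ × ℝ) × (ℝ × ℝ) => c (r.1.1, r.2.2)) N := by
    rw [hPN] at hIP; exact hIP.comp_measurable mP
  have i4 : Integrable (fun r : (ℝ × ℝ) × (ℝ × ℝ) => c (r.2.1, r.1.2)) N := by
    rw [hQN] at hIQ; exact hIQ.comp_measurable mQ
  have v1 : ∫ r, c r.1 ∂N = b.toReal * ∫ p, c p ∂γA := by
    rw [hN, integral_fun_fst, smul_eq_mul]; rfl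
  have v2 : ∫ r, c r.2 ∂N = a.toReal * ∫ p, c p ∂γB := by
    rw [hN, integral_fun_snd, smul_eq_mul]; rfl
  have v3 : ∫ r, c (r.1.1, r.2.2) ∂N = ∫ p, c p ∂P := by
    rw [hPN, integral_map mP.aemeasurable hc.aestronglyMeasurable]
  have v4 : ∫ r, c (r.2.1, r.1.2) ∂N = ∫ p, c p ∂Q := by
    rw [hQN, integral_map mQ.aemeasurable hc.aestronglyMeasurable]
  set D : (ℝ × ℝ) × (ℝ × ℝ) → ℝ :=
    fun r => (c r.1 + c r.2) - (c (r.1.1, r.2.2) + c (r.2.1, r.1.2)) with hD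
  have hDi : Integrable D N := (i1.add i2).sub (i3.add i4)
  have hDle : ∫ r, D r ∂N ≤ 0 := by
    have : ∫ r, D r ∂N = (∫ r, c r.1 ∂N + ∫ r, c r.2 ∂N)
        - (∫ r, c (r.1.1, r.2.2) ∂N + ∫ r, c (r.2.1, r.1.2) ∂N) := by
      rw [← integral_add i1 i2, ← integral_add i3 i4]
      exact integral_sub (i1.add i2) (i3.add i4)
    rw [this, v1, v2, v3, v4]
    linarith
  have hDpos : ∀ᵐ r ∂N, 0 < D r := by
    have : N = (γ.prod γ).restrict (A ×ˢ B) := Measure.prod_restrict A B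
    rw [this]
    filter_upwards [ae_restrict_mem (hA.prod hB)] with r hr
    have := hh.exchange_lt (lt_of_le_of_lt hr.1.1 hr.2.1) (lt_of_le_of_lt hr.2.2 hr.1.2)
    simp only [hD, hcdef]
    linarith
  have hsupp : 0 < N (Function.support D) := by
    have : N (Function.support D) = N univ := by
      refine measure_congr ?_
      filter_upwards [hDpos] with r hr
      exact propext ⟨fun _ => trivial, fun _ => hr.ne'⟩
    rw [this, hN, ← univ_prod_univ, Measure.prod_prod]
    exact ENNReal.mul_pos ha0 hb0
  have := (integral_pos_iff_support_of_nonneg_ae (hDpos.mono fun r hr => hr.le) hDi).2 hsupp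
  linarith

/-- A two-by-two table of masses with one vanishing off-diagonal entry is determined by its
marginals. -/
theorem real_prod_Iic_of_null_or_null {γ : Measure (ℝ × ℝ)} [IsFiniteMeasure γ] {t y : ℝ}
    (h : γ (Iic t ×ˢ Ioi y) = 0 ∨ γ (Ioi t ×ˢ Iic y) = 0) :
    γ.real (Iic t ×ˢ Iic y) = min (γ.fst.real (Iic t)) (γ.snd.real (Iic y)) ∧
      γ.real (Ioi t ×ˢ Iic y) = max (γ.snd.real (Iic y) - γ.fst.real (Iic t)) 0 := by
  have e1 : γ.fst.real (Iic t) = γ.real (Iic t ×ˢ Iic y) + γ.real (Iic t ×ˢ Ioi y) := by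
    rw [measureReal_def, Measure.fst_apply measurableSet_Iic, ← measureReal_def,
      ← measureReal_union _ (measurableSet_Iic.prod measurableSet_Ioi), ← prod_union,
      Iic_union_Ioi, prod_univ]
    exact (Iic_disjoint_Ioi le_rfl).set_prod_right _ _
  have e2 : γ.snd.real (Iic y) = γ.real (Iic t ×ˢ Iic y) + γ.real (Ioi t ×ˢ Iic y) := by
    rw [measureReal_def, Measure.snd_apply measurableSet_Iic, ← measureReal_def,
      ← measureReal_union _ (measurableSet_Ioi.prod measurableSet_Iic), ← union_prod,
      Iic_union_Ioi, univ_prod]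
    exact (Iic_disjoint_Ioi le_rfl).set_prod_left _ _
  have n1 : 0 ≤ γ.real (Iic t ×ˢ Ioi y) := measureReal_nonneg
  have n2 : 0 ≤ γ.real (Ioi t ×ˢ Iic y) := measureReal_nonneg
  rcases h with h | h
  · have h' : γ.real (Iic t ×ˢ Ioi y) = 0 := by rw [measureReal_def, h, ENNReal.toReal_zero]
    rw [e1, e2, h', min_eq_left (by linarith), max_eq_left (by linarith)]
    constructor <;> ring
  · have h' : γ.real (Ioi t ×ˢ Iic y) = 0 := by rw [measureReal_def, h, ENNReal.toReal_zero]
    rw [e1, e2, h', min_eq_right (by linarith), max_eq_right (by linarith)]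
    constructor <;> ring

/-! ### Cells, partitions and one iteration -/

theorem measurableSet_basicCell (n i : ℕ) : MeasurableSet (basicCell n i) := measurableSet_Icc

theorem basicCell_subset_compositeCell (n : ℕ) {i : ℕ} {J : Finset ℕ} (hi : i ∈ J) :
    basicCell n i ⊆ compositeCell n J :=
  subset_biUnion_of_mem (u := basicCell n) (Finset.mem_coe.2 hi)

theorem basicCell_subset_Icc {n i : ℕ} (hi : i < n) : basicCell n i ⊆ Icc 0 1 := by
  have hn : (0 : ℝ) < n := by exact_mod_cast Nat.zero_lt_of_lt hi
  refine Icc_subset_Icc (by positivity) ?_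
  rw [div_le_one hn]
  exact_mod_cast hi

theorem volume_basicCell {n : ℕ} (hn : 0 < n) (i : ℕ) : volume (basicCell n i) = (n : ℝ≥0∞)⁻¹ := by
  have hn' : (0 : ℝ) < n := by exact_mod_cast hn
  rw [basicCell, Real.volume_Icc, ← sub_div, add_sub_cancel_left, one_div,
    ENNReal.ofReal_inv_of_pos hn', ENNReal.ofReal_natCast]

theorem unitLebesgue_basicCell {n i : ℕ} (hi : i < n) :
    unitLebesgue (basicCell n i) = (n : ℝ≥0∞)⁻¹ := by
  rw [unitLebesgue, Measure.restrict_eq_self _ (basicCell_subset_Icc hi),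
    volume_basicCell (Nat.zero_lt_of_lt hi)]

theorem volume_basicCell_inter {n i j : ℕ} (hij : i ≠ j) :
    volume (basicCell n i ∩ basicCell n j) = 0 := by
  wlog h : i < j generalizing i j
  · rw [inter_comm]; exact this hij.symm (by omega)
  have h1 : ((i : ℝ) + 1) / n ≤ (j : ℝ) / n := by
    gcongr
    exact_mod_cast h
  exact measure_mono_null (t := {(j : ℝ) / n})
    (fun x hx => le_antisymm (hx.1.2.trans h1) hx.2.1) (measure_singleton _)

theorem volume_basicCell_inter_compositeCell {n i : ℕ} {J : Finset ℕ} (hi : i ∉ J) :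
    volume (basicCell n i ∩ compositeCell n J) = 0 := by
  rw [compositeCell, inter_iUnion₂]
  refine (measure_biUnion_null_iff J.countable_toSet).2 fun j hj => volume_basicCell_inter ?_
  rintro rfl
  exact hi hj

theorem partialMarginal_apply {π : Measure (ℝ × ℝ)} {S T : Set ℝ} (hT : MeasurableSet T) :
    partialMarginal π S T = π (S ×ˢ T) := by
  rw [partialMarginal, Measure.snd_apply hT, Measure.restrict_apply (measurable_snd hT)]
  congr 1
  ext p
  simp [and_comm]

/-- The properties of a plan that are preserved by the domain decomposition iteration. -/
structure IsCellPlan (Y : Set ℝ) (n : ℕ) (π : Measure (ℝ × ℝ)) : Prop where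
  finite : IsFiniteMeasure π
  fst_ac : π.fst ≪ volume
  fst_cell : ∀ i < n, π.fst (basicCell n i) = (n : ℝ≥0∞)⁻¹
  snd_compl : π.snd Yᶜ = 0

/-- The index sets in `P` are disjoint and cover `{0, …, n - 1}`. -/
structure IsIndexPartition (n : ℕ) (P : Finset (Finset ℕ)) : Prop where
  eq_of_mem : ∀ J ∈ P, ∀ J' ∈ P, ∀ i ∈ J, i ∈ J' → J = J'
  exists_mem : ∀ i < n, ∃ J ∈ P, i ∈ J

theorem isIndexPartition_image {n N : ℕ} {f : ℕ → ℕ} (hf : ∀ i < n, f i < N) :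
    IsIndexPartition n
      ((Finset.range N).image fun j => (Finset.range n).filter fun i => f i = j) where
  eq_of_mem J hJ J' hJ' i hi hi' := by
    obtain ⟨j, -, rfl⟩ := Finset.mem_image.1 hJ
    obtain ⟨j', -, rfl⟩ := Finset.mem_image.1 hJ'
    rw [← (Finset.mem_filter.1 hi).2, ← (Finset.mem_filter.1 hi').2]
  exists_mem i hi := ⟨_, Finset.mem_image_of_mem _ (Finset.mem_range.2 (hf i hi)),
    Finset.mem_filter.2 ⟨Finset.mem_range.2 hi, rfl⟩⟩

theorem isIndexPartition_compositePartition {n : ℕ} (hn : Even n) (k : ℕ) :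
    IsIndexPartition n (compositePartition n k) := by
  obtain ⟨m, rfl⟩ := hn
  rw [compositePartition]
  split_ifs
  · exact isIndexPartition_image fun i hi => by omega
  · exact isIndexPartition_image fun i hi => by omega

section Step

variable {Y : Set ℝ} {n : ℕ} {h : ℝ → ℝ} {π : Measure (ℝ × ℝ)} {P : Finset (Finset ℕ)}
  {γ : Finset ℕ → Measure (ℝ × ℝ)}

theorem transportPlans_univ_le_one {J : Finset ℕ} {ν : Measure ℝ} {ρ : Measure (ℝ × ℝ)}
    (hρ : ρ ∈ transportPlans (unitLebesgue.restrict (compositeCell n J)) ν) : ρ univ ≤ 1 := by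
  rw [← Measure.fst_univ, hρ.1]
  refine (Measure.restrict_apply_le _ _).trans ?_
  simp [unitLebesgue]

theorem transportPlans_fst_ac {J : Finset ℕ} {ν : Measure ℝ} {ρ : Measure (ℝ × ℝ)}
    (hρ : ρ ∈ transportPlans (unitLebesgue.restrict (compositeCell n J)) ν) :
    ρ.fst ≪ volume := by
  rw [hρ.1]
  exact Measure.absolutelyContinuous_of_le (Measure.restrict_le_self.trans Measure.restrict_le_self)

/-- Closed cells share endpoints, but these carry no mass since the first marginals are restrictions
of Lebesgue measure. -/
theorem sum_apply_basicCell_prod (hP : IsIndexPartition n P)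
    (hγ : ∀ J ∈ P, γ J ∈ transportPlans (unitLebesgue.restrict (compositeCell n J))
      (partialMarginal π (compositeCell n J)))
    {J : Finset ℕ} (hJ : J ∈ P) {i : ℕ} (hi : i ∈ J) (T : Set ℝ) :
    (∑ J ∈ P, γ J) (basicCell n i ×ˢ T) = γ J (basicCell n i ×ˢ T) := by
  rw [Measure.finsetSum_apply]
  refine Finset.sum_eq_single_of_mem J hJ fun J' hJ' hne => ?_
  have hi' : i ∉ J' := fun hi' => hne (hP.eq_of_mem J' hJ' J hJ i hi' hi)
  refine measure_mono_null (t := Prod.fst ⁻¹' basicCell n i) (fun p hp => hp.1) ?_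
  rw [← Measure.fst_apply (measurableSet_basicCell n i), (hγ J' hJ').1,
    Measure.restrict_apply (measurableSet_basicCell n i)]
  exact Measure.absolutelyContinuous_of_le Measure.restrict_le_self
    (volume_basicCell_inter_compositeCell hi')

theorem IsCellPlan.step (hπ : IsCellPlan Y n π) (hP : IsIndexPartition n P)
    (hγ : ∀ J ∈ P, γ J ∈ transportPlans (unitLebesgue.restrict (compositeCell n J))
      (partialMarginal π (compositeCell n J))) (hY : MeasurableSet Y) :
    IsCellPlan Y n (∑ J ∈ P, γ J) where
  finite := by
    refine ⟨?_⟩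
    rw [Measure.finsetSum_apply]
    exact ENNReal.sum_lt_top.2 fun J hJ =>
      (transportPlans_univ_le_one (hγ J hJ)).trans_lt ENNReal.one_lt_top
  fst_ac := by
    refine Measure.AbsolutelyContinuous.mk fun s hs h0 => ?_
    rw [Measure.fst_apply hs, Measure.finsetSum_apply]
    refine Finset.sum_eq_zero fun J hJ => ?_
    rw [← Measure.fst_apply hs]
    exact transportPlans_fst_ac (hγ J hJ) h0
  fst_cell i hi := by
    obtain ⟨J, hJ, hiJ⟩ := hP.exists_mem i hi
    rw [Measure.fst_apply (measurableSet_basicCell n i), ← prod_univ,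
      sum_apply_basicCell_prod hP hγ hJ hiJ, prod_univ,
      ← Measure.fst_apply (measurableSet_basicCell n i), (hγ J hJ).1,
      Measure.restrict_eq_self _ (basicCell_subset_compositeCell n hiJ), unitLebesgue_basicCell hi]
  snd_compl := by
    rw [Measure.snd_apply hY.compl, Measure.finsetSum_apply]
    refine Finset.sum_eq_zero fun J hJ => ?_
    rw [← Measure.snd_apply hY.compl, (hγ J hJ).2]
    exact (Measure.snd_mono Measure.restrict_le_self).absolutelyContinuous hπ.snd_compl

/-- The value at `y` of the distribution function of the normalized marginal on cell `i`. -/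
noncomputable def cellCDF (n : ℕ) (π : Measure (ℝ × ℝ)) (y : ℝ) (i : ℕ) : ℝ :=
  n * π.real (basicCell n i ×ˢ Iic y)

theorem IsCellPlan.real_fst_cell (hπ : IsCellPlan Y n π) {i : ℕ} (hi : i < n) :
    π.fst.real (basicCell n i) = (n : ℝ)⁻¹ := by
  rw [measureReal_def, hπ.fst_cell i hi]; simp

/-- On a one-cell group the prescribed second marginal already fixes the cell marginal; optimality
plays no role. -/
theorem cellCDF_sum_singleton (hP : IsIndexPartition n P)
    (hγ : ∀ J ∈ P, γ J ∈ transportPlans (unitLebesgue.restrict (compositeCell n J))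
      (partialMarginal π (compositeCell n J)))
    {i : ℕ} (hi : {i} ∈ P) (y : ℝ) :
    cellCDF n (∑ J ∈ P, γ J) y i = cellCDF n π y i := by
  have hc : compositeCell n {i} = basicCell n i := by simp [compositeCell]
  have hm := measurableSet_basicCell n i
  obtain ⟨h1, h2⟩ := hγ _ hi
  rw [hc] at h1 h2
  rw [cellCDF, cellCDF, measureReal_def, measureReal_def,
    sum_apply_basicCell_prod hP hγ hi (Finset.mem_singleton_self i),
    ← partialMarginal_apply (π := π) measurableSet_Iic, ← h2, Measure.snd_apply measurableSet_Iic]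
  congr 2
  refine measure_congr ?_
  have h0 : ∀ᵐ p ∂γ {i}, p.1 ∈ basicCell n i := by
    refine ae_of_ae_map (p := fun x => x ∈ basicCell n i) measurable_fst.aemeasurable ?_
    change ∀ᵐ x ∂(γ {i}).fst, _
    rw [h1]
    exact ae_restrict_mem hm
  filter_upwards [h0] with p hp
  exact propext ⟨fun q => q.2, fun q => ⟨hp, q⟩⟩

/-- Apply the no-crossing property at the common endpoint `t` of the two cells. The left cell has
mass `1 / n`, which becomes the capacity one after normalization. -/
theorem IsCellPlan.cellCDF_sum_pair (hπ : IsCellPlan Y n π) (hY : IsCompact Y)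
    (hh : StrictConvexOn ℝ univ h) (hP : IsIndexPartition n P)
    (hγ : ∀ J ∈ P, IsOptimalPlan (fun x y => h (x - y))
      (unitLebesgue.restrict (compositeCell n J)) (partialMarginal π (compositeCell n J)) (γ J))
    {i : ℕ} (hi : i + 1 < n) (hJ : {i, i + 1} ∈ P) (y : ℝ) :
    cellCDF n (∑ J ∈ P, γ J) y i = min (cellCDF n π y i + cellCDF n π y (i + 1)) 1 ∧
      cellCDF n (∑ J ∈ P, γ J) y (i + 1)
        = max (cellCDF n π y i + cellCDF n π y (i + 1) - 1) 0 := by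
  have hfin := hπ.finite
  have hγ' := fun J hJ => (hγ J hJ).1
  have hn : (0 : ℝ) < n := by exact_mod_cast Nat.zero_lt_of_lt hi
  have hc : compositeCell n {i, i + 1} = basicCell n i ∪ basicCell n (i + 1) := by
    simp [compositeCell]
  set G := γ {i, i + 1} with hG
  set t : ℝ := ((i : ℝ) + 1) / n with ht
  have hopt := hγ _ hJ
  rw [← hG] at hopt
  have hG1 := transportPlans_univ_le_one hopt.1
  have hGac := transportPlans_fst_ac hopt.1
  have hGfin : IsFiniteMeasure G := ⟨hG1.trans_lt ENNReal.one_lt_top⟩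
  have hK : unitLebesgue.restrict (compositeCell n {i, i + 1}) (Icc 0 1)ᶜ = 0 := by
    refine Measure.absolutelyContinuous_of_le Measure.restrict_le_self ?_
    rw [unitLebesgue, Measure.restrict_apply measurableSet_Icc.compl, compl_inter_self,
      measure_empty]
  have hL : partialMarginal π (compositeCell n {i, i + 1}) Yᶜ = 0 :=
    (Measure.snd_mono Measure.restrict_le_self).absolutelyContinuous hπ.snd_compl
  obtain ⟨k1, k2⟩ := real_prod_Iic_of_null_or_null
    (hopt.null_or_null hh hG1 isCompact_Icc hY hK hL t y)
  have hae : ∀ᵐ x ∂G.fst, x ∈ basicCell n i ∪ basicCell n (i + 1) := by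
    rw [hopt.1.1, hc]
    exact ae_restrict_mem ((measurableSet_basicCell n i).union (measurableSet_basicCell n (i + 1)))
  -- The point `t` lies in both cells; away from it, the two half-lines separate them.
  have hne : ∀ᵐ x ∂G.fst, x ≠ t := hGac.ae_le (Measure.ae_ne volume t)
  have hlow : ∀ᵐ x ∂G.fst, (x ∈ Iic t ↔ x ∈ basicCell n i) := by
    filter_upwards [hae, hne] with x hx hxt
    refine ⟨fun hxt' => hx.resolve_right fun hx' => hxt (le_antisymm hxt' ?_), fun hx' => hx'.2⟩
    have := hx'.1
    push_cast at this
    exact this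
  have hupp : ∀ᵐ x ∂G.fst, (x ∈ Ioi t ↔ x ∈ basicCell n (i + 1)) := by
    filter_upwards [hae, hne] with x hx hxt
    refine ⟨fun hxt' => hx.resolve_left fun hx' => absurd (mem_Ioi.1 hxt') (not_lt.2 hx'.2),
      fun hx' => lt_of_le_of_ne ?_ hxt.symm⟩
    have := hx'.1
    push_cast at this
    exact this
  have e1 : G.real (Iic t ×ˢ Iic y) = G.real (basicCell n i ×ˢ Iic y) := by
    refine measureReal_congr ?_
    filter_upwards [ae_of_ae_map measurable_fst.aemeasurable hlow] with p hp
    exact propext (and_congr hp Iff.rfl)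
  have e2 : G.real (Ioi t ×ˢ Iic y) = G.real (basicCell n (i + 1) ×ˢ Iic y) := by
    refine measureReal_congr ?_
    filter_upwards [ae_of_ae_map measurable_fst.aemeasurable hupp] with p hp
    exact propext (and_congr hp Iff.rfl)
  have e3 : G.fst.real (Iic t) = (n : ℝ)⁻¹ := by
    have e : G.fst.real (Iic t) = G.fst.real (basicCell n i) :=
      measureReal_congr (hlow.mono fun x hx => propext hx)
    rw [e, hopt.1.1, measureReal_def,
      Measure.restrict_eq_self _ (basicCell_subset_compositeCell n (Finset.mem_insert_self _ _)),
      unitLebesgue_basicCell (by omega)]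
    simp
  have e4 : G.snd.real (Iic y)
      = π.real (basicCell n i ×ˢ Iic y) + π.real (basicCell n (i + 1) ×ˢ Iic y) := by
    rw [hopt.1.2, measureReal_def, partialMarginal_apply measurableSet_Iic, hc, union_prod,
      ← measureReal_def]
    refine measureReal_union₀
      ((measurableSet_basicCell n (i + 1)).prod measurableSet_Iic).nullMeasurableSet ?_
    refine measure_mono_null
      (t := Prod.fst ⁻¹' (basicCell n i ∩ basicCell n (i + 1))) (fun p hp => ⟨hp.1.1, hp.2.1⟩) ?_
    rw [← Measure.fst_apply ((measurableSet_basicCell n i).inter (measurableSet_basicCell n _))]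
    exact hπ.fst_ac (volume_basicCell_inter (by omega))
  have s1 : cellCDF n (∑ J ∈ P, γ J) y i = n * G.real (basicCell n i ×ˢ Iic y) := by
    rw [cellCDF, measureReal_def,
      sum_apply_basicCell_prod hP hγ' hJ (Finset.mem_insert_self _ _), ← measureReal_def]
  have s2 : cellCDF n (∑ J ∈ P, γ J) y (i + 1) = n * G.real (basicCell n (i + 1) ×ˢ Iic y) := by
    rw [cellCDF, measureReal_def,
      sum_apply_basicCell_prod hP hγ' hJ (Finset.mem_insert_of_mem (Finset.mem_singleton_self _)),
      ← measureReal_def]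
  rw [s1, s2, ← e1, ← e2, k1, k2, e3, e4, mul_min_of_nonneg _ _ hn.le, mul_max_of_nonneg _ _ hn.le,
    mul_sub, mul_add, mul_inv_cancel₀ hn.ne', mul_zero, min_comm]
  exact ⟨rfl, rfl⟩

theorem IsCellPlan.cellCDF_mem_Icc (hπ : IsCellPlan Y n π) (y : ℝ) {i : ℕ} (hi : i < n) :
    cellCDF n π y i ∈ Icc (0 : ℝ) 1 := by
  have hn : (0 : ℝ) < n := by exact_mod_cast Nat.zero_lt_of_lt hi
  have := hπ.finite
  refine ⟨mul_nonneg hn.le measureReal_nonneg, ?_⟩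
  rw [← mul_inv_cancel₀ hn.ne', ← hπ.real_fst_cell hi]
  refine mul_le_mul_of_nonneg_left ?_ hn.le
  rw [measureReal_def π.fst, Measure.fst_apply (measurableSet_basicCell n i), ← measureReal_def]
  exact measureReal_mono fun p hp => hp.1

end Step

/-! ### Monotonicity along the iteration -/

theorem pair_mem_compositeA {n j : ℕ} (hj : 2 * j + 1 < n) :
    {2 * j, 2 * j + 1} ∈ compositeA n := by
  refine Finset.mem_image.2 ⟨j, Finset.mem_range.2 (by omega), ?_⟩
  ext i
  simp only [Finset.mem_filter, Finset.mem_range, Finset.mem_insert, Finset.mem_singleton]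
  omega

theorem pair_mem_compositeB {n j : ℕ} (hj : 2 * j + 2 < n) :
    {2 * j + 1, 2 * j + 1 + 1} ∈ compositeB n := by
  refine Finset.mem_image.2 ⟨j + 1, Finset.mem_range.2 (by omega), ?_⟩
  ext i
  simp only [Finset.mem_filter, Finset.mem_range, Finset.mem_insert, Finset.mem_singleton]
  omega

theorem zero_mem_compositeB {n : ℕ} (hn : 0 < n) : {0} ∈ compositeB n := by
  refine Finset.mem_image.2 ⟨0, Finset.mem_range.2 (by omega), ?_⟩
  ext i
  simp only [Finset.mem_filter, Finset.mem_range, Finset.mem_singleton]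
  omega

theorem last_mem_compositeB {n : ℕ} (he : Even n) (hn : 0 < n) : {n - 1} ∈ compositeB n := by
  obtain ⟨m, rfl⟩ := he
  refine Finset.mem_image.2 ⟨(m + m) / 2, Finset.mem_range.2 (by omega), ?_⟩
  ext i
  simp only [Finset.mem_filter, Finset.mem_range, Finset.mem_singleton]
  omega

/-- The sum of the distances of second neighbours in the padded sequence of cell distribution
functions. -/
noncomputable def padVariation (n : ℕ) (π : Measure (ℝ × ℝ)) (y : ℝ) : ℝ :=
  ∑ i ∈ Finset.range (n + 6), |padSeq n (cellCDF n π y) i - padSeq n (cellCDF n π y) (i + 2)|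

theorem IsDomDecRun.isCellPlan_and_padVariation_le {Y : Set ℝ} (hY : IsCompact Y) {h : ℝ → ℝ}
    (hh : StrictConvexOn ℝ univ h) {n : ℕ} (he : Even n) (hn : 0 < n)
    {πinit : Measure (ℝ × ℝ)} (hinit : IsCellPlan Y n πinit) {π : ℕ → Measure (ℝ × ℝ)}
    (hπ : IsDomDecRun (fun x y => h (x - y)) unitLebesgue n πinit π) (k : ℕ) :
    IsCellPlan Y n (π k) ∧ ∀ y, padVariation n (π k) y ≤ padVariation n πinit y := by
  induction k with
  | zero => rw [hπ.1]; exact ⟨hinit, fun y => le_rfl⟩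
  | succ k ih =>
    obtain ⟨ihp, ihv⟩ := ih
    obtain ⟨γ, hγ, hsum⟩ := hπ.2 k
    have hP := isIndexPartition_compositePartition he (k + 1)
    have hγ' := fun J hJ => (hγ J hJ).1
    rw [hsum]
    refine ⟨ihp.step hP hγ' hY.measurableSet, fun y => le_trans ?_ (ihv y)⟩
    have pair := fun i hi hJ => ihp.cellCDF_sum_pair hY hh hP hγ (i := i) hi hJ y
    have single := fun i hi => cellCDF_sum_singleton hP hγ' (i := i) hi y
    by_cases hk : Odd (k + 1)
    · have hA : compositePartition n (k + 1) = compositeA n := if_pos hk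
      exact sum_padSeq_step_A he
        (fun j hj => (pair (2 * j) hj (hA ▸ pair_mem_compositeA hj)).1)
        (fun j hj => (pair (2 * j) hj (hA ▸ pair_mem_compositeA hj)).2)
    · have hB : compositePartition n (k + 1) = compositeB n := if_neg hk
      exact sum_padSeq_step_B he hn (fun i hi => ihp.cellCDF_mem_Icc y hi)
        (single 0 (hB ▸ zero_mem_compositeB hn))
        (single (n - 1) (hB ▸ last_mem_compositeB he hn))
        (fun j hj => (pair (2 * j + 1) hj (hB ▸ pair_mem_compositeB hj)).1)
        (fun j hj => (pair (2 * j + 1) hj (hB ▸ pair_mem_compositeB hj)).2)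

/-! ### Lipschitz functions realizing the L¹ distance -/

/-- The integral of `G` over `[z, ∞)`. -/
noncomputable def tailIntegral (G : ℝ → ℝ) (z : ℝ) : ℝ := ∫ w in Ici z, G w

theorem abs_tailIntegral_le {G : ℝ → ℝ} (hG : Integrable G) (z : ℝ) :
    |tailIntegral G z| ≤ ∫ w, ‖G w‖ :=
  (norm_integral_le_integral_norm _).trans
    (setIntegral_le_integral hG.norm (Filter.Eventually.of_forall fun _ => norm_nonneg _))

theorem lipschitzWith_tailIntegral {G : ℝ → ℝ} (hG : Integrable G) (hb : ∀ w, ‖G w‖ ≤ 1) :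
    LipschitzWith 1 (tailIntegral G) := by
  refine LipschitzWith.of_dist_le_mul fun z z' => ?_
  have h1 : tailIntegral G z - tailIntegral G z' = ∫ w in z..z', G w := by
    rw [tailIntegral, tailIntegral, integral_Ici_eq_integral_Ioi, integral_Ici_eq_integral_Ioi]
    exact intervalIntegral.integral_Ioi_sub_Ioi' hG.integrableOn hG.integrableOn
  rw [Real.dist_eq, h1, dist_comm, Real.dist_eq, NNReal.coe_one]
  exact intervalIntegral.norm_integral_le_of_norm_le_const fun w _ => hb w

/-- Fubini on the half-plane `z ≤ w`. -/
theorem integral_tailIntegral {G : ℝ → ℝ} (hG : Integrable G) (ρ : Measure ℝ)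
    [IsFiniteMeasure ρ] :
    ∫ z, tailIntegral G z ∂ρ = ∫ w, ρ.real (Iic w) * G w := by
  have hs : MeasurableSet {p : ℝ × ℝ | p.1 ≤ p.2} := measurableSet_le measurable_fst measurable_snd
  have hi : Integrable (Function.uncurry fun z w : ℝ => (Ici z).indicator G w)
      (ρ.prod volume) := by
    have : (Function.uncurry fun z w : ℝ => (Ici z).indicator G w)
        = {p : ℝ × ℝ | p.1 ≤ p.2}.indicator fun p => G p.2 := by
      ext ⟨z, w⟩
      simp [indicator_apply]
    rw [this]
    exact (hG.comp_snd ρ).indicator hs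
  calc ∫ z, tailIntegral G z ∂ρ = ∫ z, (∫ w, (Ici z).indicator G w) ∂ρ :=
        integral_congr_ae (Filter.Eventually.of_forall fun z =>
          (integral_indicator measurableSet_Ici).symm)
    _ = ∫ w, ∫ z, (Ici z).indicator G w ∂ρ := integral_integral_swap hi
    _ = ∫ w, ρ.real (Iic w) * G w := by
        refine integral_congr_ae (Filter.Eventually.of_forall fun w => ?_)
        have : (fun z => (Ici z).indicator G w) = (Iic w).indicator fun _ => G w := by
          ext z
          simp [indicator_apply]
        simp only [this]
        rw [integral_indicator measurableSet_Iic, setIntegral_const, smul_eq_mul]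

theorem monotone_real_Iic (ρ : Measure ℝ) [IsFiniteMeasure ρ] :
    Monotone fun y => ρ.real (Iic y) :=
  fun _ _ hyz => measureReal_mono (Iic_subset_Iic.2 hyz)

theorem integrableOn_real_Iic (ρ : Measure ℝ) [IsFiniteMeasure ρ] (α β : ℝ) :
    IntegrableOn (fun y => ρ.real (Iic y)) (Icc α β) :=
  ((monotone_real_Iic ρ).monotoneOn _).integrableOn_isCompact isCompact_Icc

/-- The `L¹` distance of the distribution functions is attained by a `1`-Lipschitz function. -/
theorem exists_lipschitzWith_integral_sub_eq (ρ ρ' : Measure ℝ) [IsFiniteMeasure ρ]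
    [IsFiniteMeasure ρ'] (α β : ℝ) :
    ∃ f : ℝ → ℝ, LipschitzWith 1 f ∧ (∃ C, ∀ z, ‖f z‖ ≤ C) ∧
      ∫ z, f z ∂ρ - ∫ z, f z ∂ρ' = ∫ y in Icc α β, |ρ.real (Iic y) - ρ'.real (Iic y)| := by
  set D : ℝ → ℝ := fun y => ρ.real (Iic y) - ρ'.real (Iic y)
  have hD : Measurable D :=
    (monotone_real_Iic ρ).measurable.sub (monotone_real_Iic ρ').measurable
  -- Integrating the sign of `D` against `D` yields `|D|`; the tail integral of this sign on `[α,
  -- β]` is the optimal potential.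
  set g : ℝ → ℝ := fun y => if 0 ≤ D y then 1 else -1
  have hg : Measurable g := Measurable.ite (measurableSet_le measurable_const hD)
    measurable_const measurable_const
  have hg1 : ∀ y, ‖g y‖ ≤ 1 := by
    intro y
    simp only [g]
    split_ifs <;> simp
  set G := (Icc α β).indicator g
  have hG1 : ∀ y, ‖G y‖ ≤ 1 := fun y => (norm_indicator_le_norm_self g y).trans (hg1 y)
  have hG : Integrable G := by
    rw [integrable_indicator_iff measurableSet_Icc]
    exact Measure.integrableOn_of_bounded (by simp) hg.aestronglyMeasurable
      (Filter.Eventually.of_forall hg1)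
  have hint : ∀ (m : Measure ℝ) [IsFiniteMeasure m], Integrable fun w => m.real (Iic w) * G w := by
    intro m _
    refine hG.bdd_mul (c := m.real univ) (monotone_real_Iic m).measurable.aestronglyMeasurable
      (Filter.Eventually.of_forall fun y => ?_)
    rw [Real.norm_of_nonneg measureReal_nonneg]
    exact measureReal_mono (subset_univ _)
  refine ⟨tailIntegral G, lipschitzWith_tailIntegral hG hG1, ⟨_, abs_tailIntegral_le hG⟩, ?_⟩
  rw [integral_tailIntegral hG, integral_tailIntegral hG, ← integral_sub (hint ρ) (hint ρ'),
    ← integral_indicator measurableSet_Icc]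
  congr 1
  ext y
  rw [← sub_mul]
  by_cases hy : y ∈ Icc α β
  · simp only [G, indicator_of_mem hy, g]
    change D y * _ = |D y|
    split_ifs with h
    · rw [mul_one, abs_of_nonneg h]
    · rw [mul_neg_one, abs_of_neg (not_le.1 h)]
  · simp only [G, indicator_of_notMem hy, mul_zero]

/-! ### Smoothed hat functions -/

/-- A continuous approximation of the indicator function of `(0, 1)` from below. -/
noncomputable def trapezoid (m : ℕ) (s : ℝ) : ℝ := max 0 (min 1 (m * min s (1 - s) - 1))

theorem continuous_trapezoid (m : ℕ) : Continuous (trapezoid m) := by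
  unfold trapezoid; fun_prop

theorem trapezoid_nonneg (m : ℕ) (s : ℝ) : 0 ≤ trapezoid m s := le_max_left _ _

theorem trapezoid_le_one (m : ℕ) (s : ℝ) : trapezoid m s ≤ 1 :=
  max_le zero_le_one (min_le_left _ _)

theorem trapezoid_eq_zero {m : ℕ} {s : ℝ} (h : m * min s (1 - s) ≤ 1) : trapezoid m s = 0 :=
  max_eq_left ((min_le_right _ _).trans (by linarith))

theorem tendsto_trapezoid (s : ℝ) :
    Filter.Tendsto (fun m => trapezoid m s) Filter.atTop (nhds ((Ioo 0 1).indicator 1 s)) := by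
  by_cases hs : s ∈ Ioo (0 : ℝ) 1
  · rw [indicator_of_mem hs]
    have hpos : 0 < min s (1 - s) := lt_min hs.1 (by linarith [hs.2])
    refine tendsto_const_nhds.congr' ?_
    filter_upwards [Filter.tendsto_atTop.1
      (tendsto_natCast_atTop_atTop.atTop_mul_const hpos) 2] with m hm
    rw [trapezoid, min_eq_left (by linarith)]
    simp
  · rw [indicator_of_notMem hs]
    refine tendsto_const_nhds.congr fun m => (trapezoid_eq_zero ?_).symm
    have : min s (1 - s) ≤ 0 := by
      rw [mem_Ioo, not_and_or, not_lt, not_lt] at hs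
      rcases hs with hs | hs
      · exact (min_le_left _ _).trans hs
      · exact (min_le_right _ _).trans (by linarith)
    exact (mul_nonpos_of_nonneg_of_nonpos (Nat.cast_nonneg m) this).trans zero_le_one

/-- The primitive of `trapezoid m`, a smoothed ramp. -/
noncomputable def ramp (m : ℕ) (s : ℝ) : ℝ := ∫ r in (0 : ℝ)..s, trapezoid m r

theorem hasDerivAt_ramp (m : ℕ) (s : ℝ) : HasDerivAt (ramp m) (trapezoid m s) s :=
  intervalIntegral.integral_hasDerivAt_right ((continuous_trapezoid m).intervalIntegrable _ _)
    ((continuous_trapezoid m).stronglyMeasurableAtFilter _ _) (continuous_trapezoid m).continuousAt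

theorem ramp_sub (m : ℕ) (s t : ℝ) : ramp m t - ramp m s = ∫ r in s..t, trapezoid m r :=
  intervalIntegral.integral_interval_sub_left ((continuous_trapezoid m).intervalIntegrable _ _)
    ((continuous_trapezoid m).intervalIntegrable _ _)

theorem monotone_ramp (m : ℕ) : Monotone (ramp m) := fun s t hst => by
  rw [← sub_nonneg, ramp_sub]
  exact intervalIntegral.integral_nonneg hst fun r _ => trapezoid_nonneg m r

theorem ramp_eq_zero {m : ℕ} {s : ℝ} (h : m * s ≤ 1) : ramp m s = 0 := by
  refine (intervalIntegral.integral_congr (g := fun _ => 0) fun r hr => ?_).trans (by simp)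
  refine trapezoid_eq_zero ((mul_le_mul_of_nonneg_left (min_le_left _ _) m.cast_nonneg).trans ?_)
  rcases le_max_iff.1 hr.2 with h0 | h0
  · exact (mul_nonpos_of_nonneg_of_nonpos m.cast_nonneg h0).trans zero_le_one
  · exact (mul_le_mul_of_nonneg_left h0 m.cast_nonneg).trans h

theorem ramp_eq_ramp_one {m : ℕ} {s : ℝ} (h : m * (1 - s) ≤ 1) : ramp m s = ramp m 1 := by
  rw [← sub_eq_zero, ramp_sub]
  refine (intervalIntegral.integral_congr (g := fun _ => 0) fun r hr => ?_).trans (by simp)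
  refine trapezoid_eq_zero ((mul_le_mul_of_nonneg_left (min_le_right _ _) m.cast_nonneg).trans ?_)
  rcases min_le_iff.1 hr.1 with h0 | h0
  · exact (mul_nonpos_of_nonneg_of_nonpos m.cast_nonneg (by linarith)).trans zero_le_one
  · exact (mul_le_mul_of_nonneg_left (by linarith) m.cast_nonneg).trans h

theorem ramp_nonneg (m : ℕ) (s : ℝ) : 0 ≤ ramp m s := by
  rcases le_total 0 s with h | h
  · have := monotone_ramp m h
    rwa [ramp_eq_zero (s := 0) (by simp)] at this
  · rw [ramp_eq_zero ((mul_nonpos_of_nonneg_of_nonpos m.cast_nonneg h).trans zero_le_one)]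

theorem ramp_le_one (m : ℕ) (s : ℝ) : ramp m s ≤ 1 := by
  have h1 : ramp m 1 ≤ 1 := by
    have := intervalIntegral.integral_mono_on (zero_le_one (α := ℝ))
      ((continuous_trapezoid m).intervalIntegrable _ _)
      (intervalIntegrable_const (c := (1 : ℝ)) (μ := volume)) fun r _ => trapezoid_le_one m r
    simpa [ramp] using this
  rcases le_total s 1 with h | h
  · exact (monotone_ramp m h).trans h1
  · rwa [ramp_eq_ramp_one
      ((mul_nonpos_of_nonneg_of_nonpos m.cast_nonneg (by linarith)).trans zero_le_one)]

/-- A smoothed hat function, supported in the cells `i` and `i + 1` of level `n`. -/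
noncomputable def hat (n m i : ℕ) (x : ℝ) : ℝ := ramp m (n * x - i) - ramp m (n * x - (i + 1))

theorem hat_nonneg (n m i : ℕ) (x : ℝ) : 0 ≤ hat n m i x :=
  sub_nonneg.2 (monotone_ramp m (by linarith))

/-- The sum telescopes to a difference of two ramps with values in `[0, 1]`. -/
theorem sum_hat_le_one (n m N : ℕ) (x : ℝ) : ∑ i ∈ Finset.range N, hat n m i x ≤ 1 := by
  have := Finset.sum_range_sub' (fun i : ℕ => ramp m (n * x - i)) N
  simp only [Nat.cast_add, Nat.cast_one] at this
  unfold hat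
  rw [this]
  linarith [ramp_nonneg m (n * x - N), ramp_le_one m (n * x - (0 : ℕ))]

theorem hasDerivAt_hat (n m i : ℕ) (x : ℝ) : HasDerivAt (hat n m i)
    (n * (trapezoid m (n * x - i) - trapezoid m (n * x - (i + 1)))) x := by
  have h : ∀ c : ℝ, HasDerivAt (fun x : ℝ => ramp m (n * x - c)) (trapezoid m (n * x - c) * n) x :=
    fun c => (hasDerivAt_ramp m _).comp x
      (by simpa using ((hasDerivAt_id x).const_mul (n : ℝ)).sub_const c)
  exact ((h i).sub (h (i + 1))).congr_deriv (by ring)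

theorem deriv_hat (n m i : ℕ) : deriv (hat n m i) =
    fun x => n * (trapezoid m (n * x - i) - trapezoid m (n * x - (i + 1))) :=
  funext fun x => (hasDerivAt_hat n m i x).deriv

theorem contDiff_hat (n m i : ℕ) : ContDiff ℝ 1 (hat n m i) := by
  rw [contDiff_one_iff_deriv]
  refine ⟨fun x => (hasDerivAt_hat n m i x).differentiableAt, ?_⟩
  have := continuous_trapezoid m
  rw [deriv_hat]
  fun_prop

/-- The trapezoid vanishes within `1 / m` of the endpoints. This margin keeps the support inside the
open interval `(0, 1)` even for the outermost cells. -/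
theorem tsupport_hat_subset {n m i : ℕ} (hn : 0 < n) (hm : 0 < m) :
    tsupport (hat n m i) ⊆ Icc ((i + 1 / m) / n) ((i + 2 - 1 / m) / n) := by
  have hn' : (0 : ℝ) < n := by exact_mod_cast hn
  have hm' : (0 : ℝ) < m := by exact_mod_cast hm
  refine closure_minimal (fun x hx => ?_) isClosed_Icc
  by_contra hx'
  refine hx ?_
  rw [mem_Icc, not_and_or, not_le, not_le, lt_div_iff₀ hn', div_lt_iff₀ hn'] at hx'
  rcases hx' with hx' | hx'
  · have h1 : n * x - i ≤ 1 / m := by linarith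
    rw [hat, ramp_eq_zero ((le_div_iff₀' hm').1 h1),
      ramp_eq_zero ((le_div_iff₀' hm').1 (by linarith)), sub_zero]
  · have h1 : 1 - (n * x - (i + 1)) ≤ 1 / m := by linarith
    rw [hat, ramp_eq_ramp_one ((le_div_iff₀' hm').1 h1),
      ramp_eq_ramp_one ((le_div_iff₀' hm').1 (by linarith)), sub_self]

theorem tsupport_hat_subset_Ioo {n m i : ℕ} (hi : i + 1 < n) (hm : 0 < m) :
    tsupport (hat n m i) ⊆ Ioo 0 1 := by
  have hn : 0 < n := by omega
  have hn' : (0 : ℝ) < n := by exact_mod_cast hn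
  have hm' : (0 : ℝ) < 1 / m := by positivity
  have hi' : (i : ℝ) + 2 ≤ n := by exact_mod_cast hi
  refine (tsupport_hat_subset hn hm).trans (Icc_subset_Ioo (by positivity) ?_)
  rw [div_lt_one hn']
  linarith

theorem hasCompactSupport_hat {n m i : ℕ} (hn : 0 < n) (hm : 0 < m) :
    HasCompactSupport (hat n m i) :=
  isCompact_Icc.of_isClosed_subset (isClosed_tsupport _) (tsupport_hat_subset hn hm)

theorem setIntegral_indicator_cell {n i : ℕ} (hi : i < n) (v : ℝ → ℝ) :
    ∫ x in Ioo (0 : ℝ) 1, v x * (Ioo (0 : ℝ) 1).indicator 1 (n * x - i)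
      = ∫ x in basicCell n i, v x := by
  have hn' : (0 : ℝ) < n := by exact_mod_cast Nat.zero_lt_of_lt hi
  have e : ∀ x, v x * (Ioo (0 : ℝ) 1).indicator 1 (n * x - i)
      = (Ioo ((i : ℝ) / n) ((i + 1) / n)).indicator v x := by
    intro x
    have : n * x - i ∈ Ioo (0 : ℝ) 1 ↔ x ∈ Ioo ((i : ℝ) / n) ((i + 1) / n) := by
      rw [mem_Ioo, mem_Ioo, div_lt_iff₀ hn', lt_div_iff₀ hn']
      constructor <;> rintro ⟨h1, h2⟩ <;> constructor <;> linarith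
    by_cases hx : x ∈ Ioo ((i : ℝ) / n) ((i + 1) / n)
    · rw [indicator_of_mem hx, indicator_of_mem (this.2 hx), Pi.one_apply, mul_one]
    · rw [indicator_of_notMem hx, indicator_of_notMem (mt this.1 hx), mul_zero]
  simp_rw [e]
  have hsub : Ioo ((i : ℝ) / n) ((i + 1) / n) ⊆ Ioo 0 1 := by
    refine Ioo_subset_Ioo (by positivity) ?_
    rw [div_le_one hn']
    exact_mod_cast hi
  rw [setIntegral_indicator measurableSet_Ioo, inter_eq_self_of_subset_right hsub, basicCell,
    integral_Icc_eq_integral_Ioo]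

theorem integrableOn_mul_trapezoid {v : ℝ → ℝ} (hv : IntegrableOn v (Ioo 0 1)) (n m : ℕ) (c : ℝ) :
    IntegrableOn (fun x => v x * trapezoid m (n * x - c)) (Ioo 0 1) := by
  have := continuous_trapezoid m
  have hc : Continuous fun x : ℝ => trapezoid m (n * x - c) := by fun_prop
  refine Integrable.mul_bdd (c := 1) hv hc.aestronglyMeasurable
    (Filter.Eventually.of_forall fun x => ?_)
  rw [Real.norm_of_nonneg (trapezoid_nonneg _ _)]
  exact trapezoid_le_one _ _

theorem tendsto_setIntegral_mul_trapezoid {n i : ℕ} (hi : i < n) {v : ℝ → ℝ}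
    (hv : IntegrableOn v (Ioo 0 1)) :
    Filter.Tendsto (fun m => ∫ x in Ioo (0 : ℝ) 1, v x * trapezoid m (n * x - i)) Filter.atTop
      (nhds (∫ x in basicCell n i, v x)) := by
  rw [← setIntegral_indicator_cell hi]
  refine tendsto_integral_of_dominated_convergence (fun x => ‖v x‖)
    (fun m => (integrableOn_mul_trapezoid hv n m i).aestronglyMeasurable) hv.norm
    (fun m => Filter.Eventually.of_forall fun x => ?_)
    (Filter.Eventually.of_forall fun x => (tendsto_trapezoid _).const_mul _)
  rw [norm_mul, Real.norm_of_nonneg (trapezoid_nonneg _ _)]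
  exact mul_le_of_le_one_right (norm_nonneg _) (trapezoid_le_one _ _)

/-- The derivative of the hat tends to `n` on cell `i` and `-n` on cell `i + 1`, so the limit is a
difference of cell averages. -/
theorem tendsto_setIntegral_mul_deriv_hat {n i : ℕ} (hi : i + 1 < n) {v : ℝ → ℝ}
    (hv : IntegrableOn v (Ioo 0 1)) :
    Filter.Tendsto (fun m => ∫ x in Ioo (0 : ℝ) 1, v x * deriv (hat n m i) x) Filter.atTop
      (nhds (n * (∫ x in basicCell n i, v x) - n * ∫ x in basicCell n (i + 1), v x)) := by
  have h1 := (tendsto_setIntegral_mul_trapezoid (by omega : i < n) hv).const_mul (n : ℝ)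
  have h2 := (tendsto_setIntegral_mul_trapezoid hi hv).const_mul (n : ℝ)
  refine (h1.sub h2).congr fun m => ?_
  rw [← mul_sub, ← integral_sub (integrableOn_mul_trapezoid hv n m _)
    (integrableOn_mul_trapezoid hv n m _), ← integral_const_mul]
  refine integral_congr_ae (Filter.Eventually.of_forall fun x => ?_)
  simp only [deriv_hat]
  push_cast
  ring

/-! ### Cell averages and the metric total variation -/

theorem integrable_of_lipschitzWith_of_bounded {f : ℝ → ℝ} (hf : LipschitzWith 1 f) {C : ℝ}
    (hC : ∀ z, ‖f z‖ ≤ C) (ρ : Measure ℝ) [IsFiniteMeasure ρ] : Integrable f ρ :=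
  Integrable.of_bound hf.continuous.aestronglyMeasurable C (Filter.Eventually.of_forall hC)

theorem integral_basicMarginal {π : Measure (ℝ × ℝ)} [IsFiniteMeasure π]
    (hπ : π.fst = unitLebesgue) {n i : ℕ} (hi : i < n) {f : ℝ → ℝ} (hf : LipschitzWith 1 f)
    {C : ℝ} (hC : ∀ z, ‖f z‖ ≤ C) :
    ∫ z, f z ∂basicMarginal unitLebesgue n π i
      = n * ∫ x in basicCell n i, ∫ z, f z ∂π.condKernel x := by
  have hm := measurableSet_basicCell n i
  have hfi : Integrable (fun p : ℝ × ℝ => f p.2) π :=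
    Integrable.of_bound (hf.continuous.comp continuous_snd).aestronglyMeasurable C
      (Filter.Eventually.of_forall fun p => hC p.2)
  rw [basicMarginal, unitLebesgue_basicCell hi, inv_inv, integral_smul_measure, partialMarginal,
    Measure.snd, integral_map measurable_snd.aemeasurable hf.continuous.aestronglyMeasurable,
    ← Measure.setIntegral_condKernel_univ_right hm hfi.integrableOn, hπ, unitLebesgue,
    Measure.restrict_restrict hm, inter_eq_self_of_subset_left (basicCell_subset_Icc hi)]
  simp

theorem integrableOn_integral_condKernel {π : Measure (ℝ × ℝ)} [IsFiniteMeasure π]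
    (hπ : π.fst = unitLebesgue) {f : ℝ → ℝ} (hf : LipschitzWith 1 f)
    {C : ℝ} (hC : ∀ z, ‖f z‖ ≤ C) :
    IntegrableOn (fun x => ∫ z, f z ∂π.condKernel x) (Ioo 0 1) := by
  have hfi : Integrable (fun p : ℝ × ℝ => f p.2) π :=
    Integrable.of_bound (hf.continuous.comp continuous_snd).aestronglyMeasurable C
      (Filter.Eventually.of_forall fun p => hC p.2)
  have := hfi.integral_condKernel
  rw [hπ] at this
  exact IntegrableOn.mono_set this Ioo_subset_Icc_self

theorem sum_lintegral_hat_le {n m : ℕ} (hm : 0 < m) (σ : Measure ℝ) :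
    ∑ i ∈ Finset.range (n - 1), ∫⁻ x, ‖hat n m i x‖ₑ ∂σ ≤ σ (Ioo 0 1) := by
  rw [← lintegral_finsetSum _ fun i _ => (contDiff_hat n m i).continuous.enorm.measurable,
    ← lintegral_indicator_one measurableSet_Ioo]
  refine lintegral_mono fun x => ?_
  by_cases hx : x ∈ Ioo (0 : ℝ) 1
  · rw [indicator_of_mem hx, Pi.one_apply]
    simp only [Real.enorm_of_nonneg (hat_nonneg n m _ x)]
    rw [← ENNReal.ofReal_sum_of_nonneg fun i _ => hat_nonneg n m i x]
    exact ENNReal.ofReal_le_one.2 (sum_hat_le_one n m _ x)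
  · refine (Finset.sum_eq_zero fun i hi => ?_).trans_le zero_le
    have : hat n m i x = 0 := by
      refine image_eq_zero_of_notMem_tsupport fun hx' => hx (tsupport_hat_subset_Ioo ?_ hm hx')
      have := Finset.mem_range.1 hi
      omega
    simp [this]

/-- The function `f i` may change with the cell because `σ` dominates the variation for every `φ`;
the hats then add up to at most `σ (Ioo 0 1)`. -/
theorem sum_ofReal_integral_le_WTV {Y : Set ℝ} {π : Measure (ℝ × ℝ)} [IsFiniteMeasure π]
    (hπ : π.fst = unitLebesgue) (n : ℕ) {f : ℕ → ℝ → ℝ} (hf : ∀ i, LipschitzWith 1 (f i))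
    (hC : ∀ i, ∃ C, ∀ z, ‖f i z‖ ≤ C) :
    ∑ i ∈ Finset.range (n - 1), ENNReal.ofReal
      (∫ z, f i z ∂basicMarginal unitLebesgue n π i
        - ∫ z, f i z ∂basicMarginal unitLebesgue n π (i + 1)) ≤ WTV Y π := by
  choose C hC using hC
  refine le_iInf₂ fun σ hσ => ?_
  refine le_of_tendsto (x := Filter.atTop)
    (f := fun m : ℕ => ∑ i ∈ Finset.range (n - 1), ENNReal.ofReal
      (∫ x in Ioo (0 : ℝ) 1, (∫ z, f i z ∂π.condKernel x) * deriv (hat n m i) x)) ?_ ?_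
  · refine tendsto_finsetSum _ fun i hi => ENNReal.tendsto_ofReal ?_
    have hi' : i + 1 < n := by have := Finset.mem_range.1 hi; omega
    rw [integral_basicMarginal hπ (by omega) (hf i) (hC i),
      integral_basicMarginal hπ hi' (hf i) (hC i)]
    exact tendsto_setIntegral_mul_deriv_hat hi' (integrableOn_integral_condKernel hπ (hf i) (hC i))
  · filter_upwards [Filter.eventually_gt_atTop 0] with m hm
    refine (Finset.sum_le_sum fun i hi => ?_).trans (sum_lintegral_hat_le hm σ)
    have hi' : i + 1 < n := by have := Finset.mem_range.1 hi; omega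
    -- This `φ` is admissible by the easy half of Kantorovich duality.
    refine hσ (fun ρ => ∫ z, f i z ∂ρ) (fun ρ hρ ρ' hρ' => ?_) (hat n m i) (contDiff_hat n m i)
      (hasCompactSupport_hat (by omega) hm) (tsupport_hat_subset_Ioo hi' hm)
    have := hρ.1
    have := hρ'.1
    exact edist_integral_le_wasserstein (hf i)
      (integrable_of_lipschitzWith_of_bounded (hf i) (hC i) ρ)
      (integrable_of_lipschitzWith_of_bounded (hf i) (hC i) ρ')

/-! ### Integration over the levels and conclusion -/

theorem IsCellPlan.isProbabilityMeasure_basicMarginal {Y : Set ℝ} {n : ℕ} {π : Measure (ℝ × ℝ)}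
    (hπ : IsCellPlan Y n π) {i : ℕ} (hi : i < n) :
    IsProbabilityMeasure (basicMarginal unitLebesgue n π i) := by
  have hn : (n : ℝ≥0∞) ≠ 0 := by exact_mod_cast (Nat.zero_lt_of_lt hi).ne'
  refine ⟨?_⟩
  rw [basicMarginal, unitLebesgue_basicCell hi, inv_inv, Measure.smul_apply,
    partialMarginal_apply MeasurableSet.univ, prod_univ,
    ← Measure.fst_apply (measurableSet_basicCell n i), hπ.fst_cell i hi, smul_eq_mul,
    ENNReal.mul_inv_cancel hn (ENNReal.natCast_ne_top n)]

theorem IsCellPlan.basicMarginal_compl {Y : Set ℝ} {n : ℕ} {π : Measure (ℝ × ℝ)}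
    (hπ : IsCellPlan Y n π) (i : ℕ) : basicMarginal unitLebesgue n π i Yᶜ = 0 :=
  (Measure.smul_absolutelyContinuous.trans
    (Measure.snd_mono Measure.restrict_le_self).absolutelyContinuous) hπ.snd_compl

theorem real_basicMarginal_Iic {n : ℕ} (π : Measure (ℝ × ℝ)) {i : ℕ} (hi : i < n) (y : ℝ) :
    (basicMarginal unitLebesgue n π i).real (Iic y) = cellCDF n π y i := by
  rw [basicMarginal, unitLebesgue_basicCell hi, inv_inv, measureReal_ennreal_smul_apply,
    measureReal_def, partialMarginal_apply measurableSet_Iic, ← measureReal_def, cellCDF]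
  simp

theorem IsCellPlan.measurable_cellCDF {Y : Set ℝ} {n : ℕ} {π : Measure (ℝ × ℝ)}
    (hπ : IsCellPlan Y n π) (i : ℕ) : Measurable fun y => cellCDF n π y i := by
  have := hπ.finite
  refine Monotone.measurable fun y z hyz => ?_
  exact mul_le_mul_of_nonneg_left
    (measureReal_mono (prod_mono_right (Iic_subset_Iic.2 hyz))) n.cast_nonneg

theorem IsCellPlan.WTVB_le {Y : Set ℝ} {n : ℕ} {π : Measure (ℝ × ℝ)} (hπ : IsCellPlan Y n π)
    {α β : ℝ} (hY : Y ⊆ Icc α β) :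
    WTVB unitLebesgue n π ≤ ∫⁻ y in Icc α β, ENNReal.ofReal (padVariation n π y) := by
  have hnull : ∀ i, basicMarginal unitLebesgue n π i (Icc α β)ᶜ = 0 := fun i =>
    measure_mono_null (compl_subset_compl.2 hY) (hπ.basicMarginal_compl i)
  calc WTVB unitLebesgue n π
      ≤ ∑ i ∈ Finset.range (n - 2), ∫⁻ y in Icc α β,
          ENNReal.ofReal |cellCDF n π y i - cellCDF n π y (i + 2)| := by
        refine Finset.sum_le_sum fun i hi => ?_
        have hi' : i + 2 < n := by have := Finset.mem_range.1 hi; omega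
        have := hπ.isProbabilityMeasure_basicMarginal (i := i) (by omega)
        have := hπ.isProbabilityMeasure_basicMarginal hi'
        refine (wasserstein_le_setLIntegral_Icc (hnull i) (hnull (i + 2))).trans_eq ?_
        simp only [real_basicMarginal_Iic π hi', real_basicMarginal_Iic π (by omega : i < n)]
    _ = ∫⁻ y in Icc α β, ∑ i ∈ Finset.range (n - 2),
          ENNReal.ofReal |cellCDF n π y i - cellCDF n π y (i + 2)| := by
        refine (lintegral_finsetSum _ fun i _ => ?_).symm
        exact (continuous_abs.measurable.comp
          ((hπ.measurable_cellCDF i).sub (hπ.measurable_cellCDF (i + 2)))).ennreal_ofReal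
    _ ≤ _ := by
        refine lintegral_mono fun y => ?_
        rw [← ENNReal.ofReal_sum_of_nonneg fun i _ => abs_nonneg _]
        exact ENNReal.ofReal_le_ofReal (sum_le_sum_padSeq n _)

theorem IsCellPlan.lintegral_padVariation_le {Y : Set ℝ} {n : ℕ} {π : Measure (ℝ × ℝ)}
    [IsFiniteMeasure π] (hfst : π.fst = unitLebesgue) (hπ : IsCellPlan Y n π) (hn : 2 ≤ n)
    (α β : ℝ) :
    ∫⁻ y in Icc α β, ENNReal.ofReal (padVariation n π y)
      ≤ 2 * WTV Y π + 4 * ENNReal.ofReal (β - α) := by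
  have hmeas : ∀ i, Measurable fun y => |cellCDF n π y i - cellCDF n π y (i + 1)| := fun i =>
    continuous_abs.measurable.comp ((hπ.measurable_cellCDF i).sub (hπ.measurable_cellCDF (i + 1)))
  -- The choice of `f` below ranges over all `i`, also beyond `n`, where a cell may be null; the
  -- normalized mass is then `0 / 0 = 0`.
  have hfin : ∀ i, IsFiniteMeasure (basicMarginal unitLebesgue n π i) := fun i => by
    refine ⟨lt_of_le_of_lt ?_ ENNReal.one_lt_top⟩
    rw [basicMarginal, Measure.smul_apply, partialMarginal_apply MeasurableSet.univ, prod_univ,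
      ← Measure.fst_apply (measurableSet_basicCell n i), hfst, smul_eq_mul, mul_comm,
      ← div_eq_mul_inv]
    exact ENNReal.div_self_le_one
  choose f hf hC hfint using fun i => exists_lipschitzWith_integral_sub_eq
    (basicMarginal unitLebesgue n π i) (basicMarginal unitLebesgue n π (i + 1)) α β
  have hsum := sum_ofReal_integral_le_WTV (Y := Y) hfst n hf hC
  calc ∫⁻ y in Icc α β, ENNReal.ofReal (padVariation n π y)
      ≤ ∫⁻ y in Icc α β, (2 * ∑ i ∈ Finset.range (n - 1),
          ENNReal.ofReal |cellCDF n π y i - cellCDF n π y (i + 1)| + 4) := by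
        refine lintegral_mono fun y => ?_
        have h1 := sum_padSeq_le hn fun i hi => hπ.cellCDF_mem_Icc y hi
        have h2 := sum_abs_sub_two_le n (cellCDF n π y)
        have h3 : 0 ≤ ∑ i ∈ Finset.range (n - 1), |cellCDF n π y i - cellCDF n π y (i + 1)| :=
          Finset.sum_nonneg fun _ _ => abs_nonneg _
        rw [← ENNReal.ofReal_sum_of_nonneg fun i _ => abs_nonneg _]
        refine (ENNReal.ofReal_le_ofReal (h1.trans (add_le_add_left h2 4))).trans_eq ?_
        rw [ENNReal.ofReal_add (by positivity) (by norm_num), ENNReal.ofReal_mul zero_le_two]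
        simp
    _ = 2 * (∑ i ∈ Finset.range (n - 1), ∫⁻ y in Icc α β,
          ENNReal.ofReal |cellCDF n π y i - cellCDF n π y (i + 1)|)
        + 4 * ENNReal.ofReal (β - α) := by
        rw [lintegral_add_right _ measurable_const, lintegral_const_mul _
          (Finset.measurable_fun_sum _ fun i _ => (hmeas i).ennreal_ofReal),
          lintegral_finsetSum _ fun i _ => (hmeas i).ennreal_ofReal, setLIntegral_const,
          Real.volume_Icc]
    _ ≤ _ := by
        gcongr
        refine le_trans (le_of_eq (Finset.sum_congr rfl fun i hi => ?_)) hsum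
        have hi' : i + 1 < n := by have := Finset.mem_range.1 hi; omega
        rw [hfint i, ofReal_integral_eq_lintegral_ofReal]
        · simp only [real_basicMarginal_Iic π hi', real_basicMarginal_Iic π (by omega : i < n)]
        · exact ((integrableOn_real_Iic _ α β).sub (integrableOn_real_Iic _ α β)).abs
        · exact Filter.Eventually.of_forall fun y => abs_nonneg _

theorem isCellPlan_of_fst_eq {Y : Set ℝ} {π : Measure (ℝ × ℝ)} [IsFiniteMeasure π]
    (hfst : π.fst = unitLebesgue) (hsnd : π.snd Yᶜ = 0) (n : ℕ) : IsCellPlan Y n π where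
  finite := inferInstance
  fst_ac := hfst ▸ Measure.absolutelyContinuous_of_le Measure.restrict_le_self
  fst_cell i hi := by rw [hfst, unitLebesgue_basicCell hi]
  snd_compl := hsnd

theorem mainTheorem7 (Y : Set ℝ) (hY : IsCompact Y)
    (h : ℝ → ℝ) (hh : StrictConvexOn ℝ univ h)
    (ν : Measure ℝ) [IsProbabilityMeasure ν] (hν : ν Yᶜ = 0)
    (πinit : Measure (ℝ × ℝ)) [IsProbabilityMeasure πinit]
    (hinit : πinit ∈ transportPlans unitLebesgue ν)
    (π : ℕ → ℕ → Measure (ℝ × ℝ))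
    (hπ : ∀ n : ℕ, Even n → 0 < n →
      IsDomDecRun (fun x y => h (x - y)) unitLebesgue n πinit (π n)) :
    (∀ n : ℕ, Even n → 0 < n → ∀ k : ℕ,
      WTVB unitLebesgue n (π n k) ≤ 2 * WTV Y πinit + 4 * Metric.ediam Y) ∧
    (WTV Y πinit < ∞ →
      (⨆ (n : ℕ) (_ : Even n ∧ 0 < n) (k : ℕ), WTVB unitLebesgue n (π n k)) < ∞) := by
  have hne : Y.Nonempty := by
    rw [nonempty_iff_ne_empty]
    rintro rfl
    simp at hν
  have hsub : Y ⊆ Icc (sInf Y) (sSup Y) := fun y hy =>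
    ⟨csInf_le hY.bddBelow hy, le_csSup hY.bddAbove hy⟩
  -- Compactness puts both extremes in `Y`, so enlarging `Y` to an interval does not increase the
  -- diameter.
  have hdiam : ENNReal.ofReal (sSup Y - sInf Y) ≤ Metric.ediam Y := by
    refine le_trans ?_ (Metric.edist_le_ediam_of_mem (hY.sSup_mem hne) (hY.sInf_mem hne))
    rw [edist_dist, Real.dist_eq]
    exact ENNReal.ofReal_le_ofReal (le_abs_self _)
  have key : ∀ n : ℕ, Even n → 0 < n → ∀ k : ℕ,
      WTVB unitLebesgue n (π n k) ≤ 2 * WTV Y πinit + 4 * Metric.ediam Y := by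
    intro n he hn k
    have hcell := isCellPlan_of_fst_eq hinit.1 (hinit.2 ▸ hν) n
    obtain ⟨hk, hle⟩ := (hπ n he hn).isCellPlan_and_padVariation_le hY hh he hn hcell k
    have hn2 : 2 ≤ n := by obtain ⟨m, rfl⟩ := he; omega
    calc WTVB unitLebesgue n (π n k)
        ≤ ∫⁻ y in Icc (sInf Y) (sSup Y), ENNReal.ofReal (padVariation n (π n k) y) :=
          hk.WTVB_le hsub
      _ ≤ ∫⁻ y in Icc (sInf Y) (sSup Y), ENNReal.ofReal (padVariation n πinit y) :=
          lintegral_mono fun y => ENNReal.ofReal_le_ofReal (hle y)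
      _ ≤ 2 * WTV Y πinit + 4 * ENNReal.ofReal (sSup Y - sInf Y) :=
          hcell.lintegral_padVariation_le hinit.1 hn2 _ _
      _ ≤ _ := by gcongr
  refine ⟨key, fun hW => ?_⟩
  refine lt_of_le_of_lt (iSup_le fun n => iSup_le fun hn => iSup_le fun k => key n hn.1 hn.2 k) ?_
  exact ENNReal.add_lt_top.2 ⟨ENNReal.mul_lt_top (by simp) hW,
    ENNReal.mul_lt_top (by simp) (lt_top_iff_ne_top.2 hY.isBounded.ediam_ne_top)⟩
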